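/- **Theorem B.2.** Let $\{e_n\}_{n\in\mathbb N}$ be the canonical basis of $l^2(\mathbb N)$, with inner product linear in the first component. Let $\Omega_{\mathrm{SA}}$ be the class of (possibly unbounded) self-adjoint operators $T$ on $l^2(\mathbb N)$ for which $\mathrm{span}\{e_n:n\in\mathbb N\}$ is a core, and let $S_{l^2(\mathbb N)}$ be the unit sphere of $l^2(\mathbb N)$. Write $R(z,T)=(T-zI)^{-1}$. Assume that for each $(T,x)\in\Omega_{\mathrm{SA}}\times S_{l^2(\mathbb N)}$ we have access to complex-valued evaluation functions $\hat\Lambda=\{f^{(1)}_{i,j,m},f^{(2)}_{i,j,m},f^{(3)}_{i,m}:i,j,m\in\mathbb N\}$ such that, for all $i,j,m\in\mathbb N$, $$|f^{(1)}_{i,j,m}(T)-\langle Te_j,e_i\rangle|\le K2^{-m},\qquad |f^{(2)}_{i,j,m}(T)-\langle Te_j,Te_i\rangle|\le K2^{-m},\qquad |f^{(3)}_{i,m}(x)-\langle x,e_i\rangle|\le K2^{-m},$$ where the constant $K=K(T,x)$ depends only on $T$ and $x$ and is not known to the algorithm. Then there exists a sequence of arithmetic algorithms using $\hat\Lambda$,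 $$\Gamma_N:\Omega_{\mathrm{SA}}\times S_{l^2(\mathbb N)}\times(\mathbb C\setminus\mathbb R)\to l^2(\mathbb N),\qquad N\ge 1,$$ with the properties below. Here a sequence of arithmetic algorithms means that a single Blum–Shub–Smale machine (finitely many arithmetic operations and comparisons on real and imaginary parts), which takes $N$ and $z$ as input and has an oracle for the values of $\hat\Lambda$ at $(T,x)$, always halts and outputs the finite string of coordinates of $\Gamma_N(T,x,z)$. The machine does not depend on $\hat\Lambda$ or $K$ and uses no real constants other than natural numbers. 1. For all $(T,x,z)\in\Omega_{\mathrm{SA}}\times S_{l^2(\mathbb N)}\times(\mathbb C\setminus\mathbb R)$, each $\Gamma_N(T,x,z)$ has finite support with respect to the canonical basis, and $\Gamma_N(T,x,z)\to R(z,T)x$ in $l^2(\mathbb N)$ as $N\to\infty$. 2. For any $(T,x)\in\Omega_{\mathrm{SA}}\times S_{l^2(\mathbb N)}$ there exists a constant $C(T,x)$, determined by $T$, $x$ and the function $K$ and not by the particular values of $\hat\Lambda$, such that for all $z\in\mathbb C\setminus\mathbb R$ and $N\ge 1$, $$\|\Gamma_N(T,x,z)-R(z,T)x\|\le\frac{C(T,x)}{N\,|\mathrm{Im}(z)|}.$$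 -/

import Mathlib

noncomputable section

namespace ResolventSCI

/-! ## Operators on `ℓ²(ℕ)` -/

/-- The Hilbert space of square-summable complex sequences. -/
abbrev Ell2 : Type := lp (fun _ : ℕ => ℂ) 2

/-- The canonical basis vector `e n` (the basis is indexed from `0`). -/
def e (n : ℕ) : Ell2 := lp.single 2 n (1 : ℂ)

/-- The linear span of the canonical basis, i.e. the finitely supported sequences. -/
def finSpan : Submodule ℂ Ell2 := Submodule.span ℂ (Set.range e)

/-- The closed densely defined operators for which the span of the canonical basis is a core,
both of the operator and of its adjoint. -/
structure IsCanonical (T : Ell2 →ₗ.[ℂ] Ell2) : Prop where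
  dense_domain : Dense (T.domain : Set Ell2)
  closed : T.IsClosed
  core : T.HasCore finSpan
  core_adjoint : T.adjoint.HasCore finSpan

/-- The class of (possibly unbounded) self-adjoint operators having the span of the canonical
basis as a core. -/
def OmegaSA : Type := {T : Ell2 →ₗ.[ℂ] Ell2 // IsCanonical T ∧ IsSelfAdjoint T}

theorem OmegaSA.basis_mem (T : OmegaSA) (n : ℕ) : e n ∈ T.1.domain :=
  T.2.1.core.le_domain (Submodule.subset_span ⟨n, rfl⟩)

/-- The `n`-th column `T e_n` of the operator. -/
def OmegaSA.col (T : OmegaSA) (n : ℕ) : Ell2 := T.1 ⟨e n, T.basis_mem n⟩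

/-- The unit sphere of `ℓ²(ℕ)`. -/
abbrev UnitSphere : Type := Metric.sphere (0 : Ell2) 1

/-- The complex numbers that are not real. -/
abbrev NonReal : Type := {z : ℂ // z.im ≠ 0}

/-- `R` is an everywhere defined, bounded, two-sided inverse of `T - z I`. -/
def IsResolventAt (T : Ell2 →ₗ.[ℂ] Ell2) (z : ℂ) (R : Ell2 →L[ℂ] Ell2) : Prop :=
  (∀ x : Ell2, ∃ h : R x ∈ T.domain, T ⟨R x, h⟩ - z • R x = x) ∧
    ∀ y : T.domain, R (T y - z • (y : Ell2)) = y

/-- The resolvent set, i.e. the complement of the spectrum. -/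
def resolventSet (T : Ell2 →ₗ.[ℂ] Ell2) : Set ℂ := {z | ∃ R, IsResolventAt T z R}

open Classical in
/-- The resolvent operator `R(z,T) = (T - z I)⁻¹`; it has the junk value `0` at points `z` of the
spectrum. -/
def resolventOp (z : ℂ) (T : Ell2 →ₗ.[ℂ] Ell2) : Ell2 →L[ℂ] Ell2 :=
  if h : z ∈ resolventSet T then h.choose else 0

/-! ## Inexact evaluation functions -/

/-- A family of complex-valued evaluation functions, two families on operators and one on
vectors. -/
structure EvaluationFunctions where
  /-- `entry i j m T` is the approximation of level `m` to `⟨T e_j, e_i⟩`. -/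
  entry : ℕ → ℕ → ℕ → OmegaSA → ℂ
  /-- `gram i j m T` is the approximation of level `m` to `⟨T e_j, T e_i⟩`. -/
  gram : ℕ → ℕ → ℕ → OmegaSA → ℂ
  /-- `coeff i m x` is the approximation of level `m` to `⟨x, e_i⟩`. -/
  coeff : ℕ → ℕ → UnitSphere → ℂ

/-- The evaluation functions are accurate to `K(T,x) 2⁻ᵐ` at level `m`. Mathlib's `inner` is
linear in its second argument, so `inner ℂ u v` is the inner product `⟨v, u⟩` that is linear in
the first component. -/
def EvaluationFunctions.AccurateWith (Λ : EvaluationFunctions)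
    (K : OmegaSA → UnitSphere → ℝ) : Prop :=
  ∀ (T : OmegaSA) (x : UnitSphere) (m : ℕ),
    (∀ i j, ‖Λ.entry i j m T - inner ℂ (e i) (T.col j)‖ ≤ K T x * (2 : ℝ)⁻¹ ^ m) ∧
    (∀ i j, ‖Λ.gram i j m T - inner ℂ (T.col i) (T.col j)‖ ≤ K T x * (2 : ℝ)⁻¹ ^ m) ∧
    (∀ i, ‖Λ.coeff i m x - inner ℂ (e i) (x : Ell2)‖ ≤ K T x * (2 : ℝ)⁻¹ ^ m)

/-- The information about one fixed input that a machine can query. -/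
structure Oracle where
  entry : ℕ → ℕ → ℕ → ℂ
  gram : ℕ → ℕ → ℕ → ℂ
  coeff : ℕ → ℕ → ℂ

/-- The values of the evaluation functions at the input `(T, x)`. -/
def EvaluationFunctions.oracle (Λ : EvaluationFunctions) (T : OmegaSA) (x : UnitSphere) :
    Oracle where
  entry i j m := Λ.entry i j m T
  gram i j m := Λ.gram i j m T
  coeff i m := Λ.coeff i m x

/-! ## Blum–Shub–Smale machines with an oracle

A machine over the real numbers with finitely many instructions. It has registers for real
numbers, addressed by natural numbers, and index registers for natural numbers; real registers are
always addressed indirectly, through index registers. The program contains no real constants other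
than natural numbers, so everything it computes from rational data is rational. -/

/-- Operations on indices; subtraction is truncated, and division is rounded down. -/
inductive IdxOp
  | add | sub | mul | div

def IdxOp.eval : IdxOp → ℕ → ℕ → ℕ
  | .add, a, b => a + b
  | .sub, a, b => a - b
  | .mul, a, b => a * b
  | .div, a, b => a / b

/-- The arithmetic operations on real numbers. Division by zero returns zero, which makes no
difference, as a machine can test whether a number is zero. -/
inductive RealOp
  | add | sub | mul | div

def RealOp.eval : RealOp → ℝ → ℝ → ℝ
  | .add, a, b => a + b
  | .sub, a, b => a - b
  | .mul, a, b => a * b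
  | .div, a, b => a / b

/-- The instructions. Write `I[a]` for index register `a` and `R[k]` for real register `k`. -/
inductive Instr
  /-- `I[d] := c` -/
  | idxConst (d c : ℕ)
  /-- `I[d] := I[a] op I[b]` -/
  | idxOp (op : IdxOp) (d a b : ℕ)
  /-- go to line `l` if `I[a] ≤ I[b]` -/
  | idxJumpLe (a b l : ℕ)
  /-- `R[I[d]] := I[a]` -/
  | realOfIdx (d a : ℕ)
  /-- `R[I[d]] := R[I[a]]` -/
  | realCopy (d a : ℕ)
  /-- `R[I[d]] := R[I[a]] op R[I[b]]` -/
  | realOp (op : RealOp) (d a b : ℕ)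
  /-- go to line `l` if `R[I[a]] ≤ R[I[b]]` -/
  | realJumpLe (a b l : ℕ)
  /-- put real and imaginary part of `entry I[i] I[j] I[m]` into `R[I[d]]` and `R[I[d]+1]` -/
  | readEntry (d i j m : ℕ)
  /-- put real and imaginary part of `gram I[i] I[j] I[m]` into `R[I[d]]` and `R[I[d]+1]` -/
  | readGram (d i j m : ℕ)
  /-- put real and imaginary part of `coeff I[i] I[m]` into `R[I[d]]` and `R[I[d]+1]` -/
  | readCoeff (d i m : ℕ)

/-- A program is a finite list of instructions, on lines `0, 1, 2, …`. -/
abbrev Program : Type := List Instr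

/-- The state of a machine. -/
@[ext]
structure State where
  pc : ℕ
  idx : ℕ → ℕ
  reg : ℕ → ℝ

namespace State

/-- Go to the next line. -/
def next (s : State) : State := { s with pc := s.pc + 1 }

/-- Go to line `l` if the condition holds, and otherwise to the next line. -/
def jumpIf (s : State) (p : Prop) [Decidable p] (l : ℕ) : State :=
  { s with pc := if p then l else s.pc + 1 }

def setIdx (s : State) (d v : ℕ) : State := { s with idx := Function.update s.idx d v }

def setReg (s : State) (k : ℕ) (v : ℝ) : State := { s with reg := Function.update s.reg k v }

/-- Store a complex number as its real and imaginary part in two consecutive registers. -/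
def setComplex (s : State) (k : ℕ) (w : ℂ) : State := (s.setReg k w.re).setReg (k + 1) w.im

/-- The input: `N` in index register `0`, real and imaginary part of `z` in the real registers
`0` and `1`, and zero everywhere else. -/
def init (N : ℕ) (z : ℂ) : State where
  pc := 0
  idx := Function.update (fun _ => 0) 0 N
  reg := Function.update (Function.update (fun _ => 0) 0 z.re) 1 z.im

/-- The output: a finite string of complex numbers, whose length is in index register `0` and
whose `k`-th member has its real and imaginary part in the real registers `2k` and `2k+1`; it is
identified with the finitely supported sequence that has these coordinates. -/
def output (s : State) : Ell2 :=
  ∑ k ∈ Finset.range (s.idx 0), (⟨s.reg (2 * k), s.reg (2 * k + 1)⟩ : ℂ) • e k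

end State

open Classical in
/-- The execution of a single instruction. -/
def Instr.exec (O : Oracle) (s : State) : Instr → State
  | .idxConst d c => (s.setIdx d c).next
  | .idxOp op d a b => (s.setIdx d (op.eval (s.idx a) (s.idx b))).next
  | .idxJumpLe a b l => s.jumpIf (s.idx a ≤ s.idx b) l
  | .realOfIdx d a => (s.setReg (s.idx d) (s.idx a : ℝ)).next
  | .realCopy d a => (s.setReg (s.idx d) (s.reg (s.idx a))).next
  | .realOp op d a b =>
      (s.setReg (s.idx d) (op.eval (s.reg (s.idx a)) (s.reg (s.idx b)))).next
  | .realJumpLe a b l => s.jumpIf (s.reg (s.idx a) ≤ s.reg (s.idx b)) l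
  | .readEntry d i j m => (s.setComplex (s.idx d) (O.entry (s.idx i) (s.idx j) (s.idx m))).next
  | .readGram d i j m => (s.setComplex (s.idx d) (O.gram (s.idx i) (s.idx j) (s.idx m))).next
  | .readCoeff d i m => (s.setComplex (s.idx d) (O.coeff (s.idx i) (s.idx m))).next

/-- The machine has halted when there is no instruction on the current line. -/
def Program.Halted (P : Program) (s : State) : Prop := P.length ≤ s.pc

/-- One step of the machine; a halted machine does not change its state any more. -/
def Program.step (P : Program) (O : Oracle) (s : State) : State :=
  match P[s.pc]? with
  | none => s
  | some c => c.exec O s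

/-- With oracle `O`, the machine halts on input `(N, z)` after finitely many steps and outputs
`v`. -/
def Program.Computes (P : Program) (O : Oracle) (N : ℕ) (z : ℂ) (v : Ell2) : Prop :=
  ∃ t : ℕ, P.Halted ((P.step O)^[t] (State.init N z)) ∧
    ((P.step O)^[t] (State.init N z)).output = v

end ResolventSCI

end

noncomputable section

/-! ### Self-adjoint operators: the resolvent off the real axis and the residual bound. -/

namespace ResolventSCI

open Filter Topology

variable {T : Ell2 →ₗ.[ℂ] Ell2}

/-! For self-adjoint T the number ⟨Ty, y⟩ is real, so |Im z| ‖y‖ ≤ ‖(T - z)y‖. Hence any y in the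
domain is within ‖(T - z)y - x‖ / |Im z| of R(z,T)x (`norm_sub_resolventOp_le`), and it suffices to
find a finitely supported y with residual O(1/N). Such y exist because the finitely supported
vectors form a core (`exists_finSpan_norm_lt`).

The residual itself is not a finite expression in the available data: its square contains ⟨Ty, x⟩,
an infinite series. A second finitely supported vector v, standing in for Ty, cures this. As ‖x‖ =
1, the functional ‖Ty - v‖² + ‖v - zy - x‖² is a finite expression in the three kinds of inner
products (`objective_exactOracle`), and its square root controls the residual. Reading the oracle at
level m changes it by at most K 2⁻ᵐ B, with B computable from y, v and z (`abs_objective_sub_le`).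
Since K is unknown, a candidate is accepted when the computed functional and B/(m+1) are both small
on the scale N⁻²; from 2⁻ᵐ ≤ 1/(m+1) the exact functional is then at most (1+K)N⁻²
(`norm_sub_resolventOp_le_of_stopValue_lt`).

The machine searches through all triples (y, v, m) with rational coordinates, coded as pairs of
natural numbers by Gödel's β function. The search succeeds by the core property, rational
approximation, and a large choice of m (`exists_stopAt_lt`). The program is compiled from
expressions and verified by Hoare-style rules for `Leads`, ending in `Machine.exists_computes`.
Convergence follows from the error bound. -/

theorem inner_map_of_isSelfAdjoint (hT : IsSelfAdjoint T) (y w : T.domain) :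
    inner ℂ (T y) (w : Ell2) = inner ℂ (y : Ell2) (T w) := by
  have h := LinearPMap.adjoint_isFormalAdjoint hT.dense_domain
  rw [LinearPMap.isSelfAdjoint_def.mp hT] at h
  exact h y w

/-- As ⟨Ty, y⟩ is real, ⟨(T - z)y, y⟩ has imaginary part -Im z ‖y‖²; Cauchy–Schwarz does the rest.
-/
theorem im_mul_norm_le (hT : IsSelfAdjoint T) (z : ℂ) (y : T.domain) :
    |z.im| * ‖(y : Ell2)‖ ≤ ‖T y - z • (y : Ell2)‖ := by
  have hreal : (inner ℂ (y : Ell2) (T y)).im = 0 := by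
    have h := inner_map_of_isSelfAdjoint hT y y
    rw [← inner_conj_symm] at h
    have := congrArg Complex.im h
    simp only [Complex.conj_im] at this
    linarith
  have him : (inner ℂ (y : Ell2) (T y - z • (y : Ell2))).im = -(z.im * ‖(y : Ell2)‖ ^ 2) := by
    rw [inner_sub_right, inner_smul_right, inner_self_eq_norm_sq_to_K, Complex.sub_im, hreal]
    simp [← Complex.ofReal_pow]
  have hle : |z.im| * ‖(y : Ell2)‖ ^ 2 ≤ ‖(y : Ell2)‖ * ‖T y - z • (y : Ell2)‖ := by
    calc |z.im| * ‖(y : Ell2)‖ ^ 2 = |(inner ℂ (y : Ell2) (T y - z • (y : Ell2))).im| := by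
          rw [him, abs_neg, abs_mul, abs_of_nonneg (sq_nonneg ‖(y : Ell2)‖)]
      _ ≤ ‖inner ℂ (y : Ell2) (T y - z • (y : Ell2))‖ := Complex.abs_im_le_norm _
      _ ≤ _ := norm_inner_le_norm _ _
  rcases (norm_nonneg (y : Ell2)).eq_or_lt with h0 | h0
  · rw [← h0, mul_zero]
    exact norm_nonneg _
  · refine le_of_mul_le_mul_left ?_ h0
    linarith

/-- The map `y ↦ T y - z y` on the domain of `T`. -/
def shift (T : Ell2 →ₗ.[ℂ] Ell2) (z : ℂ) : T.domain →ₗ[ℂ] Ell2 := T.toFun - z • T.domain.subtype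

theorem shift_apply (z : ℂ) (y : T.domain) : shift T z y = T y - z • (y : Ell2) := rfl

/-- The graph of T is complete and (a, b) ↦ b - za is bounded below on it, so the image of this map
is closed. -/
theorem isClosed_range_shift (hT : IsSelfAdjoint T) {z : ℂ} (hz : z.im ≠ 0) :
    IsClosed ((LinearMap.range (shift T z) : Submodule ℂ Ell2) : Set Ell2) := by
  have hz' : 0 < |z.im| := abs_pos.mpr hz
  have hcl : IsClosed (T.graph : Set (Ell2 × Ell2)) := hT.isClosed
  have : CompleteSpace T.graph := hcl.completeSpace_coe
  let φ : T.graph →L[ℂ] Ell2 :=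
    (ContinuousLinearMap.snd ℂ Ell2 Ell2 - z • ContinuousLinearMap.fst ℂ Ell2 Ell2).comp
      T.graph.subtypeL
  have hφ : ∀ a : T.graph, ‖a‖ ≤ (1 + (1 + ‖z‖) * |z.im|⁻¹) * ‖φ a‖ := by
    rintro ⟨⟨a, b⟩, hab⟩
    obtain ⟨y, rfl, rfl⟩ := (LinearPMap.mem_graph_iff T).mp hab
    have h1 := im_mul_norm_le hT z y
    change ‖((y : Ell2), T y)‖ ≤ _ * ‖T y - z • (y : Ell2)‖
    set r := ‖T y - z • (y : Ell2)‖
    have h2 : ‖(y : Ell2)‖ ≤ |z.im|⁻¹ * r := by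
      rw [inv_mul_eq_div, le_div_iff₀ hz']; linarith
    have h3 : ‖T y‖ ≤ r + ‖z‖ * ‖(y : Ell2)‖ := by
      rw [← norm_smul]
      calc ‖T y‖ = ‖(T y - z • (y : Ell2)) + z • (y : Ell2)‖ := by rw [sub_add_cancel]
        _ ≤ _ := norm_add_le _ _
    have h4 : 0 ≤ r := norm_nonneg _
    have h5 : ‖z‖ * ‖(y : Ell2)‖ ≤ ‖z‖ * (|z.im|⁻¹ * r) := by gcongr
    have h6 : 0 ≤ |z.im|⁻¹ * r := by positivity
    have h7 : 0 ≤ ‖z‖ * (|z.im|⁻¹ * r) := by positivity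
    refine max_le ?_ ?_ <;> dsimp only <;> nlinarith
  have hanti : AntilipschitzWith ⟨1 + (1 + ‖z‖) * |z.im|⁻¹, by positivity⟩ φ :=
    ContinuousLinearMap.antilipschitz_of_bound φ hφ
  have hr := hanti.isClosed_range φ.uniformContinuous
  convert hr using 1
  ext w
  constructor
  · rintro ⟨y, rfl⟩
    exact ⟨⟨((y : Ell2), T y), T.mem_graph y⟩, rfl⟩
  · rintro ⟨⟨⟨a, b⟩, hab⟩, rfl⟩
    obtain ⟨y, rfl, rfl⟩ := (LinearPMap.mem_graph_iff T).mp hab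
    exact ⟨y, rfl⟩

/-- A vector w orthogonal to the range satisfies T*w = z̄w. As T* = T, the lower bound at z̄ forces
w = 0, and a closed range with trivial complement is everything. -/
theorem range_shift (hT : IsSelfAdjoint T) {z : ℂ} (hz : z.im ≠ 0) :
    LinearMap.range (shift T z) = ⊤ := by
  have : CompleteSpace (LinearMap.range (shift T z)) :=
    (isClosed_range_shift hT hz).completeSpace_coe
  rw [← Submodule.orthogonal_eq_bot_iff, Submodule.eq_bot_iff]
  intro w hw
  have hw' : ∀ y : T.domain, inner ℂ (star z • w) (y : Ell2) = inner ℂ w (T y) := by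
    intro y
    have h := (Submodule.mem_orthogonal' _ w).mp hw _ (LinearMap.mem_range_self (shift T z) y)
    rw [shift_apply, inner_sub_right, inner_smul_right, sub_eq_zero] at h
    rw [h, inner_smul_left]
    simp
  have hmem : w ∈ T.adjoint.domain := LinearPMap.mem_adjoint_domain_of_exists w ⟨_, hw'⟩
  have happ := LinearPMap.adjoint_apply_eq hT.dense_domain ⟨w, hmem⟩ hw'
  have hgr : (w, star z • w) ∈ T.adjoint.graph := by
    rw [← happ]
    exact T.adjoint.mem_graph ⟨w, hmem⟩
  rw [LinearPMap.isSelfAdjoint_def.mp hT] at hgr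
  obtain ⟨y, h1, h2⟩ := (LinearPMap.mem_graph_iff T).mp hgr
  dsimp only at h1 h2
  have h3 := im_mul_norm_le hT (star z) y
  rw [h1, h2, sub_self, norm_zero] at h3
  have h4 : 0 < |(star z).im| := by simpa using hz
  have h5 : ‖w‖ ≤ 0 := by
    by_contra! h
    exact absurd h3 (not_le.mpr (mul_pos h4 h))
  exact norm_le_zero_iff.mp h5

theorem mem_resolventSet (hT : IsSelfAdjoint T) {z : ℂ} (hz : z.im ≠ 0) :
    z ∈ resolventSet T := by
  have hz' : 0 < |z.im| := abs_pos.mpr hz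
  have hinj : Function.Injective (shift T z) := by
    rw [← LinearMap.ker_eq_bot, LinearMap.ker_eq_bot']
    intro y hy
    have h := im_mul_norm_le hT z y
    rw [← shift_apply, hy, norm_zero] at h
    have h5 : ‖(y : Ell2)‖ ≤ 0 := by
      by_contra! h'
      exact absurd h (not_le.mpr (mul_pos hz' h'))
    exact Subtype.ext (norm_le_zero_iff.mp h5)
  have hsurj : Function.Surjective (shift T z) := LinearMap.range_eq_top.mp (range_shift hT hz)
  let L := LinearEquiv.ofBijective (shift T z) ⟨hinj, hsurj⟩
  have hL : ∀ x, T (L.symm x) - z • ((L.symm x : T.domain) : Ell2) = x := fun x =>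
    L.apply_symm_apply x
  let R : Ell2 →L[ℂ] Ell2 :=
    (T.domain.subtype ∘ₗ (L.symm : Ell2 →ₗ[ℂ] T.domain)).mkContinuous |z.im|⁻¹ (by
      intro x
      have h := im_mul_norm_le hT z (L.symm x)
      rw [hL] at h
      rw [inv_mul_eq_div, le_div_iff₀ hz']
      change ‖((L.symm x : T.domain) : Ell2)‖ * _ ≤ _
      linarith)
  refine ⟨R, fun x => ⟨(L.symm x).2, hL x⟩, fun y => ?_⟩
  exact congrArg Subtype.val (L.symm_apply_apply y)

theorem isResolventAt_resolventOp {z : ℂ} (hz : z ∈ resolventSet T) :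
    IsResolventAt T z (resolventOp z T) := by
  rw [resolventOp, dif_pos hz]
  exact hz.choose_spec

/-- The lower bound is applied to y - R(z,T)x, whose image under T - z is the residual of y. -/
theorem norm_sub_resolventOp_le (hT : IsSelfAdjoint T) {z : ℂ} (hz : z.im ≠ 0) (x : Ell2)
    (y : T.domain) :
    ‖(y : Ell2) - resolventOp z T x‖ ≤ ‖T y - z • (y : Ell2) - x‖ / |z.im| := by
  obtain ⟨hR, -⟩ := isResolventAt_resolventOp (mem_resolventSet hT hz)
  obtain ⟨hmem, hx⟩ := hR x
  have h := im_mul_norm_le hT z (y - ⟨_, hmem⟩)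
  rw [le_div_iff₀ (abs_pos.mpr hz), mul_comm]
  refine h.trans_eq ?_
  congr 1
  nth_rewrite 3 [← hx]
  rw [LinearPMap.map_sub, Submodule.coe_sub, smul_sub]
  abel

/-- The restriction of the shifted operator to the finitely supported sequences has dense range. -/
theorem exists_finSpan_norm_lt (hT : IsSelfAdjoint T) (hc : T.HasCore finSpan) {z : ℂ}
    (hz : z.im ≠ 0) (x : Ell2) {ε : ℝ} (hε : 0 < ε) :
    ∃ y : T.domain, (y : Ell2) ∈ finSpan ∧ ‖T y - z • (y : Ell2) - x‖ < ε := by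
  obtain ⟨y₀, hy₀⟩ := LinearMap.range_eq_top.mp (range_shift hT hz) x
  have hcl : (T.domRestrict finSpan).IsClosable :=
    hT.isClosed.isClosable.leIsClosable (LinearPMap.domRestrict_le)
  -- The core property read on graphs: the graph of T is the closure of the graph of the
  -- restriction.
  have hmem : ((y₀ : Ell2), T y₀) ∈ closure ((T.domRestrict finSpan).graph : Set (Ell2 × Ell2)) := by
    rw [← Submodule.topologicalClosure_coe, hcl.graph_closure_eq_closure_graph, hc.closure_eq]
    exact T.mem_graph y₀
  have hcont : Continuous fun a : Ell2 × Ell2 => ‖a.2 - z • a.1 - x‖ := by fun_prop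
  have hopen : IsOpen {a : Ell2 × Ell2 | ‖a.2 - z • a.1 - x‖ < ε} :=
    isOpen_lt hcont continuous_const
  obtain ⟨⟨a, b⟩, ha, hab⟩ := mem_closure_iff.mp hmem _ hopen (by
    change ‖T y₀ - z • (y₀ : Ell2) - x‖ < ε
    rw [← shift_apply, hy₀, sub_self, norm_zero]
    exact hε)
  obtain ⟨w, hw1, hw2⟩ := (LinearPMap.mem_graph_iff _).mp hab
  dsimp only at hw1 hw2
  have hwT : (w : Ell2) ∈ T.domain := w.2.2
  refine ⟨⟨w, hwT⟩, w.2.1, ?_⟩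
  have : T ⟨w, hwT⟩ = b := by
    rw [← hw2]
    exact (LinearPMap.domRestrict_apply rfl).symm
  rw [this]
  simpa [hw1] using ha

end ResolventSCI

namespace ResolventSCI

open Filter Topology ComplexConjugate

/-! ## The least squares functional -/

/-- The finitely supported vector with coordinates `y 0, …, y (n - 1)`. -/
def finVec (n : ℕ) (y : ℕ → ℂ) : Ell2 := ∑ k ∈ Finset.range n, y k • e k

/-- The image of `finVec n y` under `T`. -/
def OmegaSA.applyFin (T : OmegaSA) (n : ℕ) (y : ℕ → ℂ) : Ell2 :=
  ∑ k ∈ Finset.range n, y k • T.col k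

/-- The summand of index `(i, j)` of the functional computed from oracle values of level `m`. -/
def objTerm (O : Oracle) (z : ℂ) (m : ℕ) (y v : ℕ → ℂ) (i j : ℕ) : ℝ :=
  (conj (y i) * y j * O.gram i j m).re - 2 * (conj (v i) * y j * O.entry i j m).re +
    ((1 - (i - j) - (j - i) : ℕ) : ℝ) * (Complex.normSq (v i) + Complex.normSq (v i - z * y i) -
      2 * (conj (v i - z * y i) * O.coeff i m).re)

/-- An approximation of `‖T y - v‖² + ‖v - z y - x‖²`. -/
def objective (O : Oracle) (z : ℂ) (m n : ℕ) (y v : ℕ → ℂ) : ℝ :=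
  1 + ∑ i ∈ Finset.range n, ∑ j ∈ Finset.range n, objTerm O z m y v i j

/-- The sensitivity of `objTerm` to errors of the oracle. -/
def errTerm (z : ℂ) (y v : ℕ → ℂ) (i j : ℕ) : ℝ :=
  Complex.normSq (y i) + 2 * Complex.normSq (y j) + Complex.normSq (v i) +
    Complex.normSq (v i - z * y i) + 1

/-- The sensitivity of `objective` to errors of the oracle. -/
def errBound (z : ℂ) (n : ℕ) (y v : ℕ → ℂ) : ℝ :=
  ∑ i ∈ Finset.range n, ∑ j ∈ Finset.range n, errTerm z y v i j

/-- The oracle without errors. -/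
def exactOracle (T : OmegaSA) (x : UnitSphere) : Oracle where
  entry i j _ := inner ℂ (e i) (T.col j)
  gram i j _ := inner ℂ (T.col i) (T.col j)
  coeff i _ := inner ℂ (e i) (x : Ell2)

/-- Truncated subtraction turns the Kronecker delta into an index expression, so that one double sum
also carries the terms depending on i alone. -/
theorem kronecker_cast (i j : ℕ) :
    ((1 - (i - j) - (j - i) : ℕ) : ℝ) = if i = j then 1 else 0 := by
  split_ifs with h
  · simp [h]
  · have : 1 - (i - j) - (j - i) = 0 := by omega
    rw [this, Nat.cast_zero]

theorem inner_e (i j : ℕ) : inner ℂ (e i) (e j) = if i = j then (1 : ℂ) else 0 := by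
  rw [e, lp.inner_single_left, e, lp.single_apply]
  by_cases h : i = j
  · subst h; simp
  · simp [h]

theorem inner_finsum_finsum (n : ℕ) (a b : ℕ → ℂ) (f g : ℕ → Ell2) :
    inner ℂ (∑ k ∈ Finset.range n, a k • f k) (∑ k ∈ Finset.range n, b k • g k) =
      ∑ i ∈ Finset.range n, ∑ j ∈ Finset.range n, conj (a i) * b j * inner ℂ (f i) (g j) := by
  rw [sum_inner]
  refine Finset.sum_congr rfl fun i _ => ?_
  rw [inner_sum]
  refine Finset.sum_congr rfl fun j _ => ?_
  rw [inner_smul_left, inner_smul_right]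
  ring

theorem norm_sq_finVec (n : ℕ) (v : ℕ → ℂ) :
    ‖finVec n v‖ ^ 2 = ∑ i ∈ Finset.range n, Complex.normSq (v i) := by
  rw [← inner_self_eq_norm_sq (𝕜 := ℂ), finVec, inner_finsum_finsum]
  simp only [inner_e, mul_ite, mul_one, mul_zero]
  rw [map_sum]
  refine Finset.sum_congr rfl fun i hi => ?_
  rw [Finset.sum_ite_eq, if_pos hi, mul_comm, Complex.mul_conj]
  simp

theorem finVec_sub_smul (n : ℕ) (y v : ℕ → ℂ) (z : ℂ) :
    finVec n (fun k => v k - z * y k) = finVec n v - z • finVec n y := by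
  simp only [finVec, sub_smul, mul_smul, Finset.sum_sub_distrib, Finset.smul_sum]

/-- Both squares expand into oracle quantities; the leading 1 of `objective` is ‖x‖². -/
theorem objective_exactOracle (T : OmegaSA) (x : UnitSphere) (z : ℂ) (m n : ℕ) (y v : ℕ → ℂ) :
    objective (exactOracle T x) z m n y v =
      ‖T.applyFin n y - finVec n v‖ ^ 2 + ‖finVec n v - z • finVec n y - (x : Ell2)‖ ^ 2 := by
  rw [← finVec_sub_smul, norm_sub_sq (𝕜 := ℂ), norm_sub_sq (𝕜 := ℂ), norm_sq_finVec,
    norm_sq_finVec]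
  have hx : ‖(x : Ell2)‖ = 1 := by simp
  have h1 : ‖T.applyFin n y‖ ^ 2 = ∑ i ∈ Finset.range n, ∑ j ∈ Finset.range n,
      (conj (y i) * y j * inner ℂ (T.col i) (T.col j)).re := by
    rw [← inner_self_eq_norm_sq (𝕜 := ℂ), OmegaSA.applyFin, inner_finsum_finsum]
    simp
  have h2 : RCLike.re (inner ℂ (T.applyFin n y) (finVec n v)) =
      ∑ i ∈ Finset.range n, ∑ j ∈ Finset.range n,
        (conj (v i) * y j * inner ℂ (e i) (T.col j)).re := by
    rw [inner_re_symm, OmegaSA.applyFin, finVec, inner_finsum_finsum]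
    simp
  have h3 : RCLike.re (inner ℂ (finVec n fun k => v k - z * y k) (x : Ell2)) =
      ∑ i ∈ Finset.range n, (conj (v i - z * y i) * inner ℂ (e i) (x : Ell2)).re := by
    rw [finVec, sum_inner, map_sum]
    refine Finset.sum_congr rfl fun i _ => ?_
    rw [inner_smul_left]
    rfl
  rw [h1, h2, h3, hx]
  simp only [objective, objTerm, exactOracle, kronecker_cast, ite_mul, one_mul, zero_mul,
    Finset.sum_add_distrib, Finset.sum_sub_distrib, ← Finset.mul_sum]
  have h4 : ∀ g : ℕ → ℝ, (∑ i ∈ Finset.range n, ∑ j ∈ Finset.range n,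
      if i = j then g i else 0) = ∑ i ∈ Finset.range n, g i := fun g =>
    Finset.sum_congr rfl fun i hi => by rw [Finset.sum_ite_eq, if_pos hi]
  rw [h4 fun i => Complex.normSq (v i) + Complex.normSq (v i - z * y i) -
    2 * (conj (v i - z * y i) * inner ℂ (e i) (x : Ell2)).re]
  simp only [Finset.sum_add_distrib, Finset.sum_sub_distrib, ← Finset.mul_sum]
  ring

/-- The oracle `O` has errors of at most `δ` on level `m`. -/
def Oracle.CloseTo (O O' : Oracle) (m : ℕ) (δ : ℝ) : Prop :=
  (∀ i j, ‖O.entry i j m - O'.entry i j m‖ ≤ δ) ∧ (∀ i j, ‖O.gram i j m - O'.gram i j m‖ ≤ δ) ∧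
    ∀ i, ‖O.coeff i m - O'.coeff i m‖ ≤ δ

theorem abs_re_mul_sub_le (a g g' : ℂ) {δ : ℝ} (h : ‖g - g'‖ ≤ δ) :
    |(a * g).re - (a * g').re| ≤ ‖a‖ * δ := by
  rw [← Complex.sub_re, ← mul_sub]
  refine (Complex.abs_re_le_norm _).trans ?_
  rw [norm_mul]
  gcongr

/-- Products of norms are replaced by sums of squares through 2ab ≤ a² + b²; the sensitivity then
needs no square roots and is within reach of the machine. -/
theorem abs_objTerm_sub_le {O O' : Oracle} {m : ℕ} {δ : ℝ} (h : O.CloseTo O' m δ) (z : ℂ)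
    (y v : ℕ → ℂ) (i j : ℕ) :
    |objTerm O z m y v i j - objTerm O' z m y v i j| ≤ δ * errTerm z y v i j := by
  have hδ : 0 ≤ δ := (norm_nonneg _).trans (h.2.2 0)
  have h1 := abs_re_mul_sub_le (conj (y i) * y j) _ _ (h.2.1 i j)
  have h2 := abs_re_mul_sub_le (conj (v i) * y j) _ _ (h.1 i j)
  have h3 := abs_re_mul_sub_le (conj (v i - z * y i)) _ _ (h.2.2 i)
  simp only [norm_mul, Complex.norm_conj] at h1 h2 h3
  simp only [objTerm, errTerm, Complex.normSq_eq_norm_sq, kronecker_cast]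
  have h4 : ‖y i‖ * ‖y j‖ * δ ≤ δ * (‖y i‖ ^ 2 + ‖y j‖ ^ 2) := by
    rw [mul_comm _ δ]
    gcongr
    nlinarith [sq_nonneg (‖y i‖ - ‖y j‖), sq_nonneg ‖y i‖, sq_nonneg ‖y j‖]
  have h5 : 2 * (‖v i‖ * ‖y j‖ * δ) ≤ δ * (‖v i‖ ^ 2 + ‖y j‖ ^ 2) := by
    rw [mul_comm _ δ, mul_left_comm]
    gcongr
    nlinarith [sq_nonneg (‖v i‖ - ‖y j‖)]
  have h6 : 2 * (‖v i - z * y i‖ * δ) ≤ δ * (‖v i - z * y i‖ ^ 2 + 1) := by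
    rw [mul_comm _ δ, mul_left_comm]
    gcongr
    nlinarith [sq_nonneg (‖v i - z * y i‖ - 1)]
  -- Needed off the diagonal, where the term with x is absent but `errTerm` still allows for it.
  have h7 : 0 ≤ δ * (‖v i - z * y i‖ ^ 2 + 1) := by positivity
  rw [abs_le] at h1 h2 h3 ⊢
  split_ifs <;> constructor <;> linarith

theorem abs_objective_sub_le {O O' : Oracle} {m : ℕ} {δ : ℝ} (h : O.CloseTo O' m δ) (z : ℂ)
    (n : ℕ) (y v : ℕ → ℂ) :
    |objective O z m n y v - objective O' z m n y v| ≤ δ * errBound z n y v := by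
  rw [objective, objective, add_sub_add_left_eq_sub, errBound, Finset.mul_sum,
    ← Finset.sum_sub_distrib]
  refine (Finset.abs_sum_le_sum_abs _ _).trans (Finset.sum_le_sum fun i _ => ?_)
  rw [Finset.mul_sum, ← Finset.sum_sub_distrib]
  exact (Finset.abs_sum_le_sum_abs _ _).trans
    (Finset.sum_le_sum fun j _ => abs_objTerm_sub_le h z y v i j)

theorem errBound_nonneg (z : ℂ) (n : ℕ) (y v : ℕ → ℂ) : 0 ≤ errBound z n y v :=
  Finset.sum_nonneg fun i _ => Finset.sum_nonneg fun j _ => by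
    have := Complex.normSq_nonneg (y i)
    have := Complex.normSq_nonneg (y j)
    have := Complex.normSq_nonneg (v i)
    have := Complex.normSq_nonneg (v i - z * y i)
    rw [errTerm]
    positivity

theorem EvaluationFunctions.AccurateWith.closeTo {Λ : EvaluationFunctions}
    {K : OmegaSA → UnitSphere → ℝ} (h : Λ.AccurateWith K) (T : OmegaSA) (x : UnitSphere) (m : ℕ) :
    (Λ.oracle T x).CloseTo (exactOracle T x) m (K T x * (2 : ℝ)⁻¹ ^ m) :=
  h T x m

theorem finVec_mem_domain (T : OmegaSA) (n : ℕ) (y : ℕ → ℂ) : finVec n y ∈ T.1.domain :=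
  Submodule.sum_mem _ fun k _ => Submodule.smul_mem _ _ (T.basis_mem k)

theorem apply_finVec (T : OmegaSA) (n : ℕ) (y : ℕ → ℂ) :
    T.1 ⟨finVec n y, finVec_mem_domain T n y⟩ = T.applyFin n y := by
  have : (⟨finVec n y, finVec_mem_domain T n y⟩ : T.1.domain) =
      ∑ k ∈ Finset.range n, y k • ⟨e k, T.basis_mem k⟩ := by
    ext1
    simp [finVec]
  rw [this, ← LinearPMap.toFun_eq_coe, map_sum]
  simp only [map_smul]
  rfl

/-! ### The stopping criterion and the error bound it implies. -/

/-- The quantity that the machine compares with `1`. -/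
def stopValue (O : Oracle) (N : ℕ) (z : ℂ) (m n : ℕ) (y v : ℕ → ℂ) : ℝ :=
  (N : ℝ) ^ 4 * (objective O z m n y v ^ 2 + (errBound z n y v / (m + 1)) ^ 2)

/-- One comparison with 1 bounds two quantities, because the stopping value is a sum of two squares.
The fourth power of N matches the squares of functionals that should be of order N⁻². -/
theorem norm_sub_resolventOp_le_of_stopValue_lt {T : OmegaSA} {x : UnitSphere} {O : Oracle}
    {K : ℝ} {m : ℕ} (hO : O.CloseTo (exactOracle T x) m (K * (2 : ℝ)⁻¹ ^ m)) {N : ℕ} (hN : 1 ≤ N)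
    {z : ℂ} (hz : z.im ≠ 0) {n : ℕ} {y v : ℕ → ℂ} (h : stopValue O N z m n y v < 1) :
    ‖finVec n y - resolventOp z T.1 (x : Ell2)‖ ≤ √(2 * (1 + K)) / (N * |z.im|) := by
  have hN' : (0 : ℝ) < N := by exact_mod_cast hN
  -- An error bound is nonnegative, hence so is K.
  have hK : 0 ≤ K := by
    have h0 := (norm_nonneg _).trans (hO.2.2 0)
    exact nonneg_of_mul_nonneg_left h0 (by positivity)
  set F := objective O z m n y v with hF
  set B := errBound z n y v with hB
  have hB0 : 0 ≤ B := errBound_nonneg z n y v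
  have hm : (0 : ℝ) < m + 1 := by positivity
  rw [stopValue, ← hF, ← hB] at h
  have hsum : (N ^ 2 * F) ^ 2 + (N ^ 2 * (B / (m + 1))) ^ 2 < 1 := by
    refine lt_of_eq_of_lt ?_ h
    ring
  -- From 2t ≤ t² + 1. Oracle errors may make F negative, which does no harm.
  have h1 : (N : ℝ) ^ 2 * F ≤ 1 := by
    nlinarith [sq_nonneg ((N : ℝ) ^ 2 * F - 1), sq_nonneg ((N : ℝ) ^ 2 * (B / (m + 1)))]
  have h2 : (N : ℝ) ^ 2 * (B / (m + 1)) ≤ 1 := by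
    nlinarith [sq_nonneg ((N : ℝ) ^ 2 * F), sq_nonneg ((N : ℝ) ^ 2 * (B / (m + 1)) - 1)]
  have h3 : K * (2 : ℝ)⁻¹ ^ m * B ≤ K * (B / (m + 1)) := by
    rw [mul_assoc]
    gcongr
    rw [inv_pow, inv_mul_eq_div]
    gcongr
    exact_mod_cast Nat.lt_two_pow_self
  have h4 := (abs_le.mp (abs_objective_sub_le hO z n y v)).1
  rw [objective_exactOracle] at h4
  set a := ‖T.applyFin n y - finVec n v‖
  set b := ‖finVec n v - z • finVec n y - (x : Ell2)‖
  have h5 : (N : ℝ) ^ 2 * (a ^ 2 + b ^ 2) ≤ 1 + K := by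
    have : a ^ 2 + b ^ 2 ≤ F + K * (B / (m + 1)) := by linarith
    calc (N : ℝ) ^ 2 * (a ^ 2 + b ^ 2) ≤ N ^ 2 * (F + K * (B / (m + 1))) := by gcongr
      _ = N ^ 2 * F + K * (N ^ 2 * (B / (m + 1))) := by ring
      _ ≤ 1 + K * 1 := by gcongr
      _ = 1 + K := by ring
  -- The factor 2 comes from (a + b)² ≤ 2(a² + b²).
  have h6 : N * (a + b) ≤ √(2 * (1 + K)) := by
    refine Real.le_sqrt_of_sq_le ?_
    nlinarith [mul_nonneg (sq_nonneg (N : ℝ)) (sq_nonneg (a - b))]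
  have h7 := norm_sub_resolventOp_le T.2.2 hz x ⟨finVec n y, finVec_mem_domain T n y⟩
  rw [apply_finVec] at h7
  refine h7.trans ?_
  rw [← div_div]
  gcongr
  rw [le_div_iff₀ hN', mul_comm]
  refine le_trans ?_ h6
  gcongr
  have : T.applyFin n y - z • finVec n y - (x : Ell2) =
    (T.applyFin n y - finVec n v) + (finVec n v - z • finVec n y - (x : Ell2)) := by abel
  change ‖T.applyFin n y - z • finVec n y - (x : Ell2)‖ ≤ _
  rw [this]
  exact norm_add_le _ _

end ResolventSCI

namespace ResolventSCI

open Filter Topology ComplexConjugate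

/-! ## Enumeration of the candidates -/

theorem tendsto_finVec (v : Ell2) : Tendsto (fun n => finVec n (v : ℕ → ℂ)) atTop (𝓝 v) := by
  have h := (lp.hasSum_single (p := 2) (by simp) v).tendsto_sum_nat
  refine h.congr fun n => Finset.sum_congr rfl fun k _ => ?_
  rw [e, ← lp.single_smul, smul_eq_mul, mul_one]

theorem exists_eq_finVec {y : Ell2} (hy : y ∈ finSpan) :
    ∃ (c : ℕ → ℂ) (n₀ : ℕ), ∀ n, n₀ ≤ n → finVec n c = y := by
  obtain ⟨c, rfl⟩ := Finsupp.mem_span_range_iff_exists_finsupp.mp hy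
  refine ⟨c, c.support.sup id + 1, fun n hn => ?_⟩
  rw [Finsupp.sum, finVec]
  refine (Finset.sum_subset (fun k hk => ?_) fun k _ hk => ?_).symm
  · have : k ≤ c.support.sup id := Finset.le_sup (f := id) hk
    exact Finset.mem_range.mpr (by omega)
  · rw [Finsupp.notMem_support_iff.mp hk, zero_smul]

/-- Take y with residual below √ε and let v be a long truncation of Ty: the first square tends to 0,
the second to the squared residual. The length is a successor because candidates are never empty. -/
theorem exists_objective_lt (T : OmegaSA) (x : UnitSphere) {z : ℂ} (hz : z.im ≠ 0) {ε : ℝ}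
    (hε : 0 < ε) : ∃ (n : ℕ) (y v : ℕ → ℂ), ∀ m,
      objective (exactOracle T x) z m (n + 1) y v < ε := by
  obtain ⟨y, hy, hlt⟩ := exists_finSpan_norm_lt T.2.2 T.2.1.core hz (x : Ell2)
    (Real.sqrt_pos.mpr hε)
  obtain ⟨c, n₀, hc⟩ := exists_eq_finVec hy
  have h1 : Tendsto (fun n => ‖T.1 y - finVec n (T.1 y : ℕ → ℂ)‖ ^ 2 +
      ‖finVec n (T.1 y : ℕ → ℂ) - z • (y : Ell2) - (x : Ell2)‖ ^ 2) atTop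
      (𝓝 (‖T.1 y - T.1 y‖ ^ 2 + ‖T.1 y - z • (y : Ell2) - (x : Ell2)‖ ^ 2)) := by
    have := tendsto_finVec (T.1 y)
    exact ((tendsto_const_nhds.sub this).norm.pow 2).add
      (((this.sub tendsto_const_nhds).sub tendsto_const_nhds).norm.pow 2)
  have h2 : ‖T.1 y - T.1 y‖ ^ 2 + ‖T.1 y - z • (y : Ell2) - (x : Ell2)‖ ^ 2 < ε := by
    rw [sub_self, norm_zero]
    have := (Real.lt_sqrt (norm_nonneg _)).mp hlt
    linarith
  obtain ⟨n, h⟩ := eventually_atTop.mp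
    ((h1.eventually_lt_const h2).and (eventually_ge_atTop n₀))
  obtain ⟨hn, hn'⟩ := h (n + 1) (by omega)
  refine ⟨n, c, (T.1 y : ℕ → ℂ), fun m => ?_⟩
  rw [objective_exactOracle]
  have h3 : T.applyFin (n + 1) c = T.1 y := by
    rw [← apply_finVec]
    congr 1
    exact Subtype.ext (hc _ hn')
  rw [h3, hc _ hn']
  exact hn

/-- The complex number that is encoded by the digits in places `a, …, a + 3` and the common
denominator in place `2`. -/
def coordOf (d : ℕ → ℕ) (a : ℕ) : ℂ :=
  ⟨((d a : ℝ) - d (a + 1)) / d 2, ((d (a + 2) : ℝ) - d (a + 3)) / d 2⟩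

/-- The signed parts of a complex number. -/
def signedPart (w : ℂ) : ℕ → ℝ
  | 0 => max w.re 0
  | 1 => max (-w.re) 0
  | 2 => max w.im 0
  | _ => max (-w.im) 0

/-- Digits that encode approximations of `y` and `v` with denominator `D`. -/
def encode (n m : ℕ) (y v : ℕ → ℂ) (D : ℕ) : ℕ → ℕ
  | 0 => n
  | 1 => m
  | 2 => D
  | i + 3 => ⌊signedPart (if i % 8 < 4 then y (i / 8) else v (i / 8)) (i % 4) * D⌋₊

/-- Digits are natural numbers, so the positive and the negative part are rounded separately. -/
theorem tendsto_floor_div (r : ℝ) :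
    Tendsto (fun D : ℕ => ((⌊max r 0 * D⌋₊ : ℝ) - ⌊max (-r) 0 * D⌋₊) / D) atTop (𝓝 r) := by
  have h := ((tendsto_nat_floor_mul_div_atTop (R := ℝ) (le_max_right r 0)).sub
    (tendsto_nat_floor_mul_div_atTop (R := ℝ) (le_max_right (-r) 0))).comp
    tendsto_natCast_atTop_atTop
  have hr : max r 0 - max (-r) 0 = r := by
    rcases le_total r 0 with h | h
    · rw [max_eq_right h, max_eq_left (by linarith)]; ring
    · rw [max_eq_left h, max_eq_right (by linarith)]; ring
  rw [hr] at h
  refine h.congr fun D => ?_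
  simp only [Function.comp_apply]
  ring

theorem tendsto_signed (w : ℂ) :
    Tendsto (fun D : ℕ => (⟨((⌊signedPart w 0 * D⌋₊ : ℝ) - ⌊signedPart w 1 * D⌋₊) / D,
      ((⌊signedPart w 2 * D⌋₊ : ℝ) - ⌊signedPart w 3 * D⌋₊) / D⟩ : ℂ)) atTop (𝓝 w) := by
  have h1 := (Complex.continuous_ofReal.tendsto _).comp (tendsto_floor_div w.re)
  have h2 := (Complex.continuous_ofReal.tendsto _).comp (tendsto_floor_div w.im)
  have h := h1.add (h2.mul_const Complex.I)
  rw [Complex.re_add_im] at h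
  refine h.congr fun D => ?_
  exact (Complex.mk_eq_add_mul_I _ _).symm

/-- After three places for length, level and denominator, each k owns eight places, four for y k and
four for v k. The right-hand side does not involve m, so the level can be chosen after the
denominator. -/
theorem coordOf_encode_left (n m : ℕ) (y v : ℕ → ℂ) (D k : ℕ) :
    coordOf (encode n m y v D) (3 + 8 * k) =
      ⟨((⌊signedPart (y k) 0 * D⌋₊ : ℝ) - ⌊signedPart (y k) 1 * D⌋₊) / D,
        ((⌊signedPart (y k) 2 * D⌋₊ : ℝ) - ⌊signedPart (y k) 3 * D⌋₊) / D⟩ := by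
  have h : ∀ r < 4, encode n m y v D (3 + 8 * k + r) = ⌊signedPart (y k) r * D⌋₊ := by
    intro r hr
    rw [show 3 + 8 * k + r = 8 * k + r + 3 by omega, encode, if_pos (by omega),
      show (8 * k + r) / 8 = k by omega, show (8 * k + r) % 4 = r by omega]
  have h0 := h 0 (by norm_num)
  rw [add_zero] at h0
  rw [coordOf, h0, h 1 (by norm_num), h 2 (by norm_num), h 3 (by norm_num)]
  rfl

theorem coordOf_encode_right (n m : ℕ) (y v : ℕ → ℂ) (D k : ℕ) :
    coordOf (encode n m y v D) (7 + 8 * k) =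
      ⟨((⌊signedPart (v k) 0 * D⌋₊ : ℝ) - ⌊signedPart (v k) 1 * D⌋₊) / D,
        ((⌊signedPart (v k) 2 * D⌋₊ : ℝ) - ⌊signedPart (v k) 3 * D⌋₊) / D⟩ := by
  have h : ∀ r < 4, encode n m y v D (7 + 8 * k + r) = ⌊signedPart (v k) r * D⌋₊ := by
    intro r hr
    rw [show 7 + 8 * k + r = 8 * k + 4 + r + 3 by omega, encode, if_neg (by omega),
      show (8 * k + 4 + r) / 8 = k by omega, show (8 * k + 4 + r) % 4 = r by omega]
  have h0 := h 0 (by norm_num)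
  rw [add_zero] at h0
  rw [coordOf, h0, h 1 (by norm_num), h 2 (by norm_num), h 3 (by norm_num)]
  rfl

theorem continuous_objective (O : Oracle) (z : ℂ) (m n : ℕ) :
    Continuous fun p : (ℕ → ℂ) × (ℕ → ℂ) => objective O z m n p.1 p.2 := by
  unfold objective objTerm
  refine continuous_const.add (continuous_finsetSum _ fun i _ => continuous_finsetSum _ fun j _ => ?_)
  have h1 : Continuous Complex.normSq := Complex.continuous_normSq
  have h2 : Continuous Complex.re := Complex.continuous_re
  fun_prop

/-- `p` modulo `(i + 1) * q + 1`. -/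
def digit (p q i : ℕ) : ℕ := p - p / ((i + 1) * q + 1) * ((i + 1) * q + 1)

/-- The machine divides with rounding but has no remainder operation, hence the form of `digit`. -/
theorem digit_eq_mod (p q i : ℕ) : digit p q i = p % ((i + 1) * q + 1) := by
  rw [digit, Nat.mod_def, mul_comm]

/-- Gödel's β lemma. The code (0, 0) is excluded because the machine advances before its first test.
-/
theorem exists_digit_eq (f : ℕ → ℕ) (l : ℕ) :
    ∃ p q, p + q ≠ 0 ∧ ∀ i < l, digit p q i = f i := by
  have h : ∃ p q, ∀ i < l, digit p q i = f i := by
    refine ⟨(Nat.unbeta (List.ofFn fun i : Fin l => f i)).unpair.1,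
      (Nat.unbeta (List.ofFn fun i : Fin l => f i)).unpair.2, fun i hi => ?_⟩
    have := Nat.beta_unbeta_coe (List.ofFn fun i : Fin l => f i) ⟨i, by simpa using hi⟩
    rw [digit_eq_mod]
    simpa [Nat.beta] using this
  obtain ⟨p, q, h⟩ := h
  by_cases hpq : p + q = 0
  · obtain ⟨rfl, rfl⟩ : p = 0 ∧ q = 0 := by omega
    -- For q = 0 every modulus is 1, so (1, 0) has the same digits as (0, 0), all zero.
    refine ⟨1, 0, by norm_num, fun i hi => ?_⟩
    rw [← h i hi]
    simp [digit]
  · exact ⟨p, q, hpq, h⟩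

/-- The next pair in the enumeration of all pairs along the antidiagonals. -/
def nextPair (a : ℕ × ℕ) : ℕ × ℕ :=
  (a.1 - 1 + (1 - a.1) * (a.2 + 1), (1 - (1 - a.1)) * (a.2 + 1))

/-- Truncated subtraction hides a case distinction: (p + 1, q) goes to (p, q + 1), and (0, q) to (q
+ 1, 0). Induction runs over the antidiagonals and along each of them. -/
theorem exists_iterate_nextPair (p q : ℕ) : ∃ i, nextPair^[i] (0, 0) = (p, q) := by
  have h : ∀ s q, q ≤ s → ∃ i, nextPair^[i] (0, 0) = (s - q, q) := by
    intro s
    induction s with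
    | zero =>
      intro q hq
      exact ⟨0, by rw [Nat.le_zero.mp hq]; rfl⟩
    | succ s ih =>
      intro q
      induction q with
      | zero =>
        intro _
        obtain ⟨i, hi⟩ := ih s le_rfl
        exact ⟨i + 1, by rw [Function.iterate_succ_apply', hi]; simp [nextPair]⟩
      | succ q ihq =>
        intro hq
        obtain ⟨i, hi⟩ := ihq (by omega)
        refine ⟨i + 1, ?_⟩
        rw [Function.iterate_succ_apply', hi, nextPair]
        have : 1 - (s + 1 - q) = 0 := by omega
        simp only [this]
        ext <;> simp
        omega
  obtain ⟨i, hi⟩ := h (p + q) q (by omega)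
  exact ⟨i, by rw [hi]; simp⟩

theorem exists_iterate_succ_nextPair {p q : ℕ} (h : p + q ≠ 0) :
    ∃ i, nextPair^[i + 1] (0, 0) = (p, q) := by
  obtain ⟨i, hi⟩ := exists_iterate_nextPair p q
  rcases i with _ | i
  · simp only [Function.iterate_zero, id_eq, Prod.mk.injEq] at hi
    omega
  · exact ⟨i, hi⟩

/-! ### Termination of the search. -/

/-- The value of the stopping criterion for the candidate `(p, q)`. -/
def stopAt (O : Oracle) (N : ℕ) (z : ℂ) (p q : ℕ) : ℝ :=
  stopValue O N z (digit p q 1) (digit p q 0 + 1) (fun k => coordOf (digit p q) (3 + 8 * k))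
    fun k => coordOf (digit p q) (7 + 8 * k)

/-- A code prescribes only finitely many digits, so coordinates agree with the intended ones only
below the length. -/
theorem stopValue_congr (O : Oracle) (N : ℕ) (z : ℂ) (m n : ℕ) {y v y' v' : ℕ → ℂ}
    (hy : ∀ k < n, y k = y' k) (hv : ∀ k < n, v k = v' k) :
    stopValue O N z m n y v = stopValue O N z m n y' v' := by
  have h1 : objective O z m n y v = objective O z m n y' v' := by
    unfold objective objTerm
    congr 1
    refine Finset.sum_congr rfl fun i hi => Finset.sum_congr rfl fun j hj => ?_
    rw [Finset.mem_range] at hi hj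
    rw [hy i hi, hv i hi, hy j hj]
  have h2 : errBound z n y v = errBound z n y' v' := by
    unfold errBound errTerm
    refine Finset.sum_congr rfl fun i hi => Finset.sum_congr rfl fun j hj => ?_
    rw [Finset.mem_range] at hi hj
    rw [hy i hi, hv i hi, hy j hj]
  rw [stopValue, stopValue, h1, h2]

/-- For a fixed candidate the oracle error and B/(m+1) both vanish as m grows, so the stopping value
tends to N⁴F². -/
theorem exists_stopValue_lt {T : OmegaSA} {x : UnitSphere} {O : Oracle} {K : ℝ}
    (hO : ∀ m, O.CloseTo (exactOracle T x) m (K * (2 : ℝ)⁻¹ ^ m)) {N : ℕ} {z : ℂ}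
    {n : ℕ} {y v : ℕ → ℂ} {F : ℝ} (hF : ∀ m, objective (exactOracle T x) z m n y v = F)
    (hF' : (N : ℝ) ^ 4 * F ^ 2 < 1) : ∃ m, stopValue O N z m n y v < 1 := by
  have h1 : Tendsto (fun m => objective O z m n y v) atTop (𝓝 F) := by
    rw [tendsto_iff_dist_tendsto_zero]
    have h0 : Tendsto (fun m : ℕ => K * (2 : ℝ)⁻¹ ^ m * errBound z n y v) atTop (𝓝 0) := by
      have := ((tendsto_pow_atTop_nhds_zero_of_lt_one (r := (2 : ℝ)⁻¹) (by norm_num)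
        (by norm_num)).const_mul K).mul_const (errBound z n y v)
      simpa using this
    refine squeeze_zero (fun _ => dist_nonneg) (fun m => ?_) h0
    rw [Real.dist_eq, ← hF m]
    exact abs_objective_sub_le (hO m) z n y v
  have h2 : Tendsto (fun m : ℕ => errBound z n y v / ((m : ℝ) + 1)) atTop (𝓝 0) :=
    tendsto_const_nhds.div_atTop
      (tendsto_atTop_add_const_right _ _ tendsto_natCast_atTop_atTop)
  have h3 : Tendsto (fun m => stopValue O N z m n y v) atTop
      (𝓝 ((N : ℝ) ^ 4 * (F ^ 2 + 0 ^ 2))) := ((h1.pow 2).add (h2.pow 2)).const_mul _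
  refine (h3.eventually_lt_const ?_).exists
  rwa [zero_pow two_ne_zero, add_zero]

theorem exists_stopAt_lt {T : OmegaSA} {x : UnitSphere} {O : Oracle} {K : ℝ}
    (hO : ∀ m, O.CloseTo (exactOracle T x) m (K * (2 : ℝ)⁻¹ ^ m)) {N : ℕ} (hN : 1 ≤ N) {z : ℂ}
    (hz : z.im ≠ 0) : ∃ i, stopAt O N z (nextPair^[i + 1] (0, 0)).1 (nextPair^[i + 1] (0, 0)).2 < 1 := by
  have hN' : (0 : ℝ) < N := by exact_mod_cast hN
  obtain ⟨n, y, v, hlt⟩ := exists_objective_lt T x hz (ε := ((N : ℝ) ^ 2)⁻¹) (by positivity)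
  -- The level 0 is provisional: it does not affect the coordinates.
  have hy : Tendsto (fun D k => coordOf (encode n 0 y v D) (3 + 8 * k)) atTop (𝓝 y) :=
    tendsto_pi_nhds.mpr fun k => by simpa only [coordOf_encode_left] using tendsto_signed (y k)
  have hv : Tendsto (fun D k => coordOf (encode n 0 y v D) (7 + 8 * k)) atTop (𝓝 v) :=
    tendsto_pi_nhds.mpr fun k => by simpa only [coordOf_encode_right] using tendsto_signed (v k)
  obtain ⟨D, hD⟩ := ((((continuous_objective (exactOracle T x) z 0 (n + 1)).tendsto (y, v)).comp
    (hy.prodMk_nhds hv)).eventually_lt_const (hlt 0)).exists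
  set y' : ℕ → ℂ := fun k => coordOf (encode n 0 y v D) (3 + 8 * k)
  set v' : ℕ → ℂ := fun k => coordOf (encode n 0 y v D) (7 + 8 * k)
  -- Nonnegativity of the exact functional allows the strict bound to be squared.
  have hD0 : 0 ≤ objective (exactOracle T x) z 0 (n + 1) y' v' := by
    rw [objective_exactOracle]
    positivity
  have hF : (N : ℝ) ^ 4 * objective (exactOracle T x) z 0 (n + 1) y' v' ^ 2 < 1 := by
    have h1 : (N : ℝ) ^ 2 * objective (exactOracle T x) z 0 (n + 1) y' v' < 1 := by
      have := mul_lt_mul_of_pos_left hD (pow_pos hN' 2)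
      rwa [mul_inv_cancel₀ (by positivity)] at this
    have h2 := pow_lt_one₀ (by positivity) h1 two_ne_zero
    rwa [mul_pow, ← pow_mul] at h2
  obtain ⟨m, hm⟩ := exists_stopValue_lt hO (fun m => rfl) hF
  obtain ⟨p, q, hpq, hdig⟩ := exists_digit_eq (encode n m y v D) (3 + 8 * (n + 1))
  obtain ⟨i, hi⟩ := exists_iterate_succ_nextPair hpq
  refine ⟨i, ?_⟩
  rw [hi]
  refine lt_of_eq_of_lt ?_ hm
  rw [stopAt, hdig 0 (by omega), hdig 1 (by omega)]
  refine stopValue_congr _ _ _ _ _ (fun k hk => ?_) fun k hk => ?_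
  all_goals
    replace hk : k < n + 1 := hk
    simp only [y', v', coordOf, hdig (2 : ℕ) (by omega)]
    first
    | rw [hdig (3 + 8 * k) (by omega), hdig (3 + 8 * k + 1) (by omega),
        hdig (3 + 8 * k + 2) (by omega), hdig (3 + 8 * k + 3) (by omega)]
    | rw [hdig (7 + 8 * k) (by omega), hdig (7 + 8 * k + 1) (by omega),
        hdig (7 + 8 * k + 2) (by omega), hdig (7 + 8 * k + 3) (by omega)]
  · have h := coordOf_encode_left n m y v D k
    rw [← coordOf_encode_left n 0 y v D k] at h
    exact h
  · have h := coordOf_encode_right n m y v D k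
    rw [← coordOf_encode_right n 0 y v D k] at h
    exact h

end ResolventSCI

namespace ResolventSCI

/-! ## Running code -/

/-- The effect of a list of instructions that are executed one after the other. -/
def execList (O : Oracle) (c : List Instr) (s : State) : State :=
  c.foldl (fun s i => i.exec O s) s

theorem execList_append (O : Oracle) (c c' : List Instr) (s : State) :
    execList O (c ++ c') s = execList O c' (execList O c s) := List.foldl_append

theorem execList_cons (O : Oracle) (i : Instr) (c : List Instr) (s : State) :
    execList O (i :: c) s = execList O c (i.exec O s) := rfl

theorem execList_nil (O : Oracle) (s : State) : execList O [] s = s := rfl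

/-- The instruction always continues on the next line. -/
def Instr.Straight (i : Instr) : Prop := ∀ O s, (i.exec O s).pc = s.pc + 1

/-- The instructions of `c` stand in `P` from line `l` on. -/
def CodeAt (P : Program) (l : ℕ) (c : List Instr) : Prop :=
  ∃ c₁ c₂, P = c₁ ++ (c ++ c₂) ∧ c₁.length = l

theorem CodeAt.left {P : Program} {l : ℕ} {c c' : List Instr} (h : CodeAt P l (c ++ c')) :
    CodeAt P l c := by
  obtain ⟨c₁, c₂, rfl, h⟩ := h
  exact ⟨c₁, c' ++ c₂, by simp, h⟩

theorem CodeAt.right {P : Program} {l : ℕ} {c c' : List Instr} (h : CodeAt P l (c ++ c')) :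
    CodeAt P (l + c.length) c' := by
  obtain ⟨c₁, c₂, rfl, rfl⟩ := h
  exact ⟨c₁ ++ c, c₂, by simp, by simp⟩

theorem CodeAt.step {P : Program} {i : Instr} {c : List Instr} {s : State}
    (h : CodeAt P s.pc (i :: c)) (O : Oracle) : P.step O s = i.exec O s := by
  obtain ⟨c₁, c₂, rfl, h⟩ := h
  simp [Program.step, ← h]

/-- The machine gets from state `s` to state `s'`. -/
def Reach (P : Program) (O : Oracle) (s s' : State) : Prop := ∃ t, (P.step O)^[t] s = s'

theorem Reach.refl {P : Program} {O : Oracle} (s : State) : Reach P O s s := ⟨0, rfl⟩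

theorem Reach.trans {P : Program} {O : Oracle} {s s' s'' : State} (h : Reach P O s s')
    (h' : Reach P O s' s'') : Reach P O s s'' := by
  obtain ⟨t, rfl⟩ := h
  obtain ⟨t', rfl⟩ := h'
  exact ⟨t' + t, Function.iterate_add_apply _ _ _ _⟩

/-- Straight code acts as a fold over its instructions, which leaves only jumps to be treated
separately. -/
theorem CodeAt.reach {P : Program} (O : Oracle) {c : List Instr} (hc : ∀ i ∈ c, i.Straight)
    {s : State} (h : CodeAt P s.pc c) :
    Reach P O s (execList O c s) ∧ (execList O c s).pc = s.pc + c.length := by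
  induction c generalizing s with
  | nil => exact ⟨Reach.refl s, rfl⟩
  | cons i c ih =>
    have hi : (i.exec O s).pc = s.pc + 1 := hc i List.mem_cons_self O s
    obtain ⟨h1, h2⟩ := ih (fun j hj => hc j (List.mem_cons_of_mem i hj)) (s := i.exec O s)
      (hi ▸ CodeAt.right (c := [i]) h)
    refine ⟨Reach.trans ⟨1, h.step O⟩ h1, h2.trans ?_⟩
    rw [hi, List.length_cons]
    ring

/-- The machine gets from `s` to a state on line `l` in which `Q` holds. -/
def Leads (P : Program) (O : Oracle) (s : State) (l : ℕ) (Q : State → Prop) : Prop :=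
  ∃ s', Reach P O s s' ∧ s'.pc = l ∧ Q s'

theorem Leads.bind {P : Program} {O : Oracle} {s : State} {l l' : ℕ} {Q Q' : State → Prop}
    (h : Leads P O s l Q) (h' : ∀ s', s'.pc = l → Q s' → Leads P O s' l' Q') :
    Leads P O s l' Q' := by
  obtain ⟨s', h1, h2, h3⟩ := h
  obtain ⟨s'', h4, h5, h6⟩ := h' s' h2 h3
  exact ⟨s'', h1.trans h4, h5, h6⟩

/-- A loop with a test at its end, which is left after the `M`-th execution of its body. -/
theorem leads_loop {P : Program} {O : Oracle} {l l' M : ℕ} (hM : 0 < M) (Q : ℕ → State → Prop)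
    (h : ∀ i < M, ∀ s : State, s.pc = l → Q i s →
      Leads P O s (if i + 1 < M then l else l') (Q (i + 1)))
    {s : State} (hs : s.pc = l) (h0 : Q 0 s) : Leads P O s l' (Q M) := by
  have key : ∀ i, i + 1 < M → Leads P O s l (Q (i + 1)) := by
    intro i
    induction i with
    | zero =>
      intro hi
      simpa [hi] using h 0 hM s hs h0
    | succ i ih =>
      intro hi
      refine (ih (by omega)).bind fun s' hs' hQ => ?_
      simpa [hi] using h (i + 1) (by omega) s' hs' hQ
  obtain ⟨M, rfl⟩ := Nat.exists_eq_succ_of_ne_zero hM.ne'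
  rcases M with _ | M
  · simpa using h 0 hM s hs h0
  · refine (key M (by omega)).bind fun s' hs' hQ => ?_
    simpa using h (M + 1) (by omega) s' hs' hQ

/-! ## Index expressions -/

/-- Expressions in the index registers `0, …, 5`. -/
inductive IExp
  | var (a : Fin 6)
  | const (c : ℕ)
  | op (o : IdxOp) (a b : IExp)

namespace IExp

instance : Add IExp := ⟨op .add⟩
instance : Sub IExp := ⟨op .sub⟩
instance : Mul IExp := ⟨op .mul⟩
instance : Div IExp := ⟨op .div⟩

def eval (I : ℕ → ℕ) : IExp → ℕ
  | var a => I a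
  | const c => c
  | op o a b => o.eval (a.eval I) (b.eval I)

section
variable (I : ℕ → ℕ) (a b : IExp)
@[simp] theorem eval_add : (a + b).eval I = a.eval I + b.eval I := rfl
@[simp] theorem eval_sub : (a - b).eval I = a.eval I - b.eval I := rfl
@[simp] theorem eval_mul : (a * b).eval I = a.eval I * b.eval I := rfl
@[simp] theorem eval_div : (a / b).eval I = a.eval I / b.eval I := rfl
@[simp] theorem eval_const (c : ℕ) : (const c).eval I = c := rfl
@[simp] theorem eval_var (k : Fin 6) : (var k).eval I = I k := rfl
end

theorem eval_congr {I J : ℕ → ℕ} (h : ∀ a < 6, I a = J a) (a : IExp) : a.eval I = a.eval J := by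
  induction a with
  | var a => exact h a a.2
  | const c => rfl
  | op o a b iha ihb => simp only [eval, iha, ihb]

/-- Code that puts the value of the expression into index register `d`. -/
def code : IExp → ℕ → List Instr
  | var a, d => [.idxConst d 0, .idxOp .add d d a]
  | const c, d => [.idxConst d c]
  | op o a b, d => a.code d ++ (b.code (d + 1) ++ [.idxOp o d d (d + 1)])

theorem straight_code (a : IExp) (d : ℕ) : ∀ i ∈ a.code d, i.Straight := by
  induction a generalizing d with
  | var a =>
    simp only [code, List.forall_mem_cons]
    exact ⟨fun _ _ => rfl, fun _ _ => rfl, by simp⟩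
  | const c =>
    simp only [code, List.forall_mem_cons]
    exact ⟨fun _ _ => rfl, by simp⟩
  | op o a b iha ihb =>
    simp only [code, List.forall_mem_append, List.forall_mem_cons]
    exact ⟨iha d, ihb (d + 1), fun _ _ => rfl, by simp⟩

/-- The registers from d on form a stack: the second operand is computed one place higher and leaves
the first intact. The bound on d keeps the variables off the stack. -/
theorem execList_code (O : Oracle) (a : IExp) {d : ℕ} (hd : 6 ≤ d) (s : State) :
    (execList O (a.code d) s).idx d = a.eval s.idx ∧
      (∀ r < d, (execList O (a.code d) s).idx r = s.idx r) ∧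
      (execList O (a.code d) s).reg = s.reg := by
  induction a generalizing d s with
  | var a =>
    have ha : (a : ℕ) ≠ d := by omega
    refine ⟨?_, fun r hr => ?_, rfl⟩
    · simp [code, execList, Instr.exec, State.setIdx, State.next, IdxOp.eval, ha]
    · have : r ≠ d := by omega
      simp [code, execList, Instr.exec, State.setIdx, State.next, this]
  | const c =>
    refine ⟨?_, fun r hr => ?_, rfl⟩
    · simp [code, execList, Instr.exec, State.setIdx, State.next]
    · have : r ≠ d := by omega
      simp [code, execList, Instr.exec, State.setIdx, State.next, this]
  | op o a b iha ihb =>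
    rw [code, execList_append, execList_append, execList_cons, execList_nil]
    obtain ⟨a1, a2, a3⟩ := iha hd s
    obtain ⟨b1, b2, b3⟩ := ihb (d := d + 1) (by omega) (execList O (a.code d) s)
    refine ⟨?_, fun r hr => ?_, ?_⟩
    · simp only [Instr.exec, State.setIdx, State.next, Function.update_self]
      rw [b1, b2 d (by omega), a1, eval_congr (fun r hr => a2 r (by omega)) b]
      rfl
    · have : r ≠ d := by omega
      simp only [Instr.exec, State.setIdx, State.next, Function.update_of_ne this]
      rw [b2 r (by omega), a2 r hr]
    · simp only [Instr.exec, State.setIdx, State.next]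
      rw [b3, a3]

end IExp

/-! ## Real expressions -/

/-- The three kinds of questions to the oracle. -/
inductive Query
  | entry | gram | coeff

def Query.value (O : Oracle) : Query → ℕ → ℕ → ℕ → ℂ
  | entry, i, j, m => O.entry i j m
  | gram, i, j, m => O.gram i j m
  | coeff, i, _, m => O.coeff i m

def Query.instr : Query → ℕ → ℕ → ℕ → ℕ → Instr
  | entry, d, i, j, m => .readEntry d i j m
  | gram, d, i, j, m => .readGram d i j m
  | coeff, d, i, _, m => .readCoeff d i m

theorem Query.exec_instr (O : Oracle) (Q : Query) (d i j m : ℕ) (s : State) :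
    (Q.instr d i j m).exec O s =
      (s.setComplex (s.idx d) (Q.value O (s.idx i) (s.idx j) (s.idx m))).next := by
  cases Q <;> rfl

/-- Expressions in the real registers `0, …, 3`. -/
inductive RExp
  | var (a : Fin 4)
  | ofIdx (a : IExp)
  | op (o : RealOp) (a b : RExp)
  | readRe (Q : Query) (i j m : IExp)
  | readIm (Q : Query) (i j m : IExp)

/-- Code that computes the address `off + I[5]` in index register `d`. -/
def addrCode (d off : ℕ) : List Instr := [.idxConst d off, .idxOp .add d d 5]

theorem straight_addrCode (d off : ℕ) : ∀ i ∈ addrCode d off, i.Straight := by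
  simp only [addrCode, List.forall_mem_cons]
  exact ⟨fun _ _ => rfl, fun _ _ => rfl, by simp⟩

theorem execList_addrCode (O : Oracle) {d : ℕ} (hd : 6 ≤ d) (off : ℕ) (s : State) :
    (execList O (addrCode d off) s).idx d = off + s.idx 5 ∧
      (∀ r, r ≠ d → (execList O (addrCode d off) s).idx r = s.idx r) ∧
      (execList O (addrCode d off) s).reg = s.reg := by
  have h5 : 5 ≠ d := by omega
  refine ⟨?_, fun r hr => ?_, rfl⟩
  · simp [addrCode, execList, Instr.exec, State.setIdx, State.next, IdxOp.eval, h5]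
  · simp [addrCode, execList, Instr.exec, State.setIdx, State.next, hr]

namespace RExp

instance : Add RExp := ⟨op .add⟩
instance : Sub RExp := ⟨op .sub⟩
instance : Mul RExp := ⟨op .mul⟩
instance : Div RExp := ⟨op .div⟩

def eval (O : Oracle) (s : State) : RExp → ℝ
  | var a => s.reg a
  | ofIdx a => (a.eval s.idx : ℝ)
  | op o a b => o.eval (a.eval O s) (b.eval O s)
  | readRe Q i j m => (Q.value O (i.eval s.idx) (j.eval s.idx) (m.eval s.idx)).re
  | readIm Q i j m => (Q.value O (i.eval s.idx) (j.eval s.idx) (m.eval s.idx)).im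

section
variable (O : Oracle) (s : State) (a b : RExp)
@[simp] theorem eval_add : (a + b).eval O s = a.eval O s + b.eval O s := rfl
@[simp] theorem eval_sub : (a - b).eval O s = a.eval O s - b.eval O s := rfl
@[simp] theorem eval_mul : (a * b).eval O s = a.eval O s * b.eval O s := rfl
@[simp] theorem eval_ofIdx (a : IExp) : (ofIdx a).eval O s = (a.eval s.idx : ℝ) := rfl
end

theorem eval_congr {s s' : State} (h : ∀ a < 6, s.idx a = s'.idx a)
    (h' : ∀ r < 4, s.reg r = s'.reg r) (O : Oracle) (a : RExp) : a.eval O s = a.eval O s' := by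
  induction a with
  | var a => exact h' a a.2
  | ofIdx a => simp only [eval, IExp.eval_congr h]
  | op o a b iha ihb => simp only [eval, iha, ihb]
  | readRe Q i j m => simp only [eval, IExp.eval_congr h]
  | readIm Q i j m => simp only [eval, IExp.eval_congr h]

/-- Code that puts the answer of the oracle into the real registers `off + I[5]` and
`off + 1 + I[5]`. -/
def readCode (Q : Query) (i j m : IExp) (off : ℕ) : List Instr :=
  i.code 6 ++ (j.code 7 ++ (m.code 8 ++ (addrCode 9 off ++ [Q.instr 9 6 7 8])))

/-- Code that puts the value of the expression into real register `off + I[5]`. -/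
def code : RExp → ℕ → List Instr
  | var a, off => addrCode 6 off ++ [.idxConst 7 a, .realCopy 6 7]
  | ofIdx a, off => a.code 6 ++ (addrCode 7 off ++ [.realOfIdx 7 6])
  | op o a b, off => a.code off ++ (b.code (off + 1) ++
      (addrCode 6 off ++ (addrCode 7 (off + 1) ++ [.realOp o 6 6 7])))
  | readRe Q i j m, off => readCode Q i j m off
  | readIm Q i j m, off => readCode Q i j m off ++
      (addrCode 6 off ++ (addrCode 7 (off + 1) ++ [.realCopy 6 7]))

theorem straight_readCode (Q : Query) (i j m : IExp) (off : ℕ) :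
    ∀ c ∈ readCode Q i j m off, c.Straight := by
  simp only [readCode, List.forall_mem_append, List.forall_mem_cons]
  refine ⟨i.straight_code _, j.straight_code _, m.straight_code _, straight_addrCode _ _,
    fun O s => ?_, by simp⟩
  rw [Query.exec_instr]
  rfl

theorem straight_code (a : RExp) (off : ℕ) : ∀ i ∈ a.code off, i.Straight := by
  induction a generalizing off with
  | var a =>
    simp only [code, List.forall_mem_append, List.forall_mem_cons]
    exact ⟨straight_addrCode _ _, fun _ _ => rfl, fun _ _ => rfl, by simp⟩
  | ofIdx a =>
    simp only [code, List.forall_mem_append, List.forall_mem_cons]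
    exact ⟨a.straight_code _, straight_addrCode _ _, fun _ _ => rfl, by simp⟩
  | op o a b iha ihb =>
    simp only [code, List.forall_mem_append, List.forall_mem_cons]
    exact ⟨iha _, ihb _, straight_addrCode _ _, straight_addrCode _ _, fun _ _ => rfl, by simp⟩
  | readRe Q i j m => exact straight_readCode Q i j m off
  | readIm Q i j m =>
    simp only [code, List.forall_mem_append, List.forall_mem_cons]
    exact ⟨straight_readCode Q i j m off, straight_addrCode _ _, straight_addrCode _ _,
      fun _ _ => rfl, by simp⟩

/-- An answer fills two stack places; both are recorded because `readIm` copies the second onto the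
first. -/
theorem execList_readCode (O : Oracle) (Q : Query) (i j m : IExp) (off : ℕ) (s : State) :
    (∀ r < 6, (execList O (readCode Q i j m off) s).idx r = s.idx r) ∧
      (∀ r < off + s.idx 5, (execList O (readCode Q i j m off) s).reg r = s.reg r) ∧
      (execList O (readCode Q i j m off) s).reg (off + s.idx 5) =
        (Q.value O (i.eval s.idx) (j.eval s.idx) (m.eval s.idx)).re ∧
      (execList O (readCode Q i j m off) s).reg (off + 1 + s.idx 5) =
        (Q.value O (i.eval s.idx) (j.eval s.idx) (m.eval s.idx)).im := by
  rw [readCode, execList_append, execList_append, execList_append, execList_append,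
    execList_cons, execList_nil, Query.exec_instr]
  obtain ⟨i1, i2, i3⟩ := i.execList_code O (d := 6) (by omega) s
  set s1 := execList O (i.code 6) s
  obtain ⟨j1, j2, j3⟩ := j.execList_code O (d := 7) (by omega) s1
  set s2 := execList O (j.code 7) s1
  obtain ⟨m1, m2, m3⟩ := m.execList_code O (d := 8) (by omega) s2
  set s3 := execList O (m.code 8) s2
  obtain ⟨a1, a2, a3⟩ := execList_addrCode O (d := 9) (by omega) off s3
  set s4 := execList O (addrCode 9 off) s3
  have h2 : ∀ r < 6, s2.idx r = s.idx r := fun r hr => by rw [j2 r (by omega), i2 r hr]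
  have h3 : ∀ r < 6, s3.idx r = s.idx r := fun r hr => by rw [m2 r (by omega), h2 r hr]
  have e6 : s4.idx 6 = i.eval s.idx := by
    rw [a2 6 (by omega), m2 6 (by omega), j2 6 (by omega), i1]
  have e7 : s4.idx 7 = j.eval s.idx := by
    rw [a2 7 (by omega), m2 7 (by omega), j1]
    exact IExp.eval_congr i2 j
  have e8 : s4.idx 8 = m.eval s.idx := by
    rw [a2 8 (by omega), m1]
    exact IExp.eval_congr h2 m
  rw [e6, e7, e8, a1, h3 5 (by omega)]
  simp only [State.setComplex, State.setReg, State.next]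
  refine ⟨fun r hr => ?_, fun r hr => ?_, ?_, ?_⟩
  · rw [a2 r (by omega), h3 r hr]
  · rw [Function.update_of_ne (by omega), Function.update_of_ne (by omega), a3, m3, j3, i3]
  · rw [Function.update_of_ne (by omega), Function.update_self]
  · rw [add_right_comm, Function.update_self]

/-- The same stack discipline in the real registers from the pointer I[5] on; the hypothesis keeps
the variables 0 to 3 below the stack. -/
theorem execList_code (O : Oracle) (a : RExp) (off : ℕ) (s : State) (hs : 4 ≤ s.idx 5) :
    (∀ r < 6, (execList O (a.code off) s).idx r = s.idx r) ∧
      (∀ r < off + s.idx 5, (execList O (a.code off) s).reg r = s.reg r) ∧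
      (execList O (a.code off) s).reg (off + s.idx 5) = a.eval O s := by
  induction a generalizing off s with
  | var a =>
    rw [code, execList_append, execList_cons, execList_cons, execList_nil]
    obtain ⟨a1, a2, a3⟩ := execList_addrCode O (d := 6) (by omega) off s
    set s1 := execList O (addrCode 6 off) s
    simp only [Instr.exec, State.setIdx, State.setReg, State.next, Function.update_self,
      Function.update_of_ne (show (6 : ℕ) ≠ 7 by omega), a1, a3]
    refine ⟨fun r hr => ?_, fun r hr => ?_, rfl⟩
    · rw [Function.update_of_ne (by omega), a2 r (by omega)]
    · rw [Function.update_of_ne (by omega)]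
  | ofIdx a =>
    rw [code, execList_append, execList_append, execList_cons, execList_nil]
    obtain ⟨i1, i2, i3⟩ := a.execList_code O (d := 6) (by omega) s
    set s1 := execList O (a.code 6) s
    obtain ⟨a1, a2, a3⟩ := execList_addrCode O (d := 7) (by omega) off s1
    set s2 := execList O (addrCode 7 off) s1
    simp only [Instr.exec, State.setReg, State.next, a1, a3, i2 5 (by omega), i3,
      a2 6 (by omega), i1]
    refine ⟨fun r hr => ?_, fun r hr => ?_, Function.update_self _ _ _⟩
    · rw [a2 r (by omega), i2 r hr]
    · rw [Function.update_of_ne (by omega)]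
  | op o a b iha ihb =>
    rw [code, execList_append, execList_append, execList_append, execList_append,
      execList_cons, execList_nil]
    obtain ⟨a1, a2, a3⟩ := iha off s hs
    set s1 := execList O (a.code off) s
    obtain ⟨b1, b2, b3⟩ := ihb (off + 1) s1 (by rw [a1 5 (by omega)]; exact hs)
    set s2 := execList O (b.code (off + 1)) s1
    obtain ⟨c1, c2, c3⟩ := execList_addrCode O (d := 6) (by omega) off s2
    set s3 := execList O (addrCode 6 off) s2
    obtain ⟨d1, d2, d3⟩ := execList_addrCode O (d := 7) (by omega) (off + 1) s3
    set s4 := execList O (addrCode 7 (off + 1)) s3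
    have h2 : s2.idx 5 = s.idx 5 := by rw [b1 5 (by omega), a1 5 (by omega)]
    have h3 : s3.idx 5 = s.idx 5 := by rw [c2 5 (by omega), h2]
    rw [a1 5 (by omega)] at b2 b3
    simp only [Instr.exec, State.setReg, State.next, d1, h3, d2 6 (by omega), c1, h2, d3, c3]
    refine ⟨fun r hr => ?_, fun r hr => ?_, ?_⟩
    · rw [d2 r (by omega), c2 r (by omega), b1 r hr, a1 r hr]
    · rw [Function.update_of_ne (by omega), b2 r (by omega), a2 r hr]
    · rw [Function.update_self, b2 _ (by omega), a3, b3,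
        eval_congr a1 (fun r hr => a2 r (by omega)) O b]
      rfl
  | readRe Q i j m =>
    obtain ⟨h1, h2, h3, -⟩ := execList_readCode O Q i j m off s
    exact ⟨h1, h2, h3⟩
  | readIm Q i j m =>
    rw [code, execList_append, execList_append, execList_append, execList_cons, execList_nil]
    obtain ⟨h1, h2, -, h4⟩ := execList_readCode O Q i j m off s
    set s2 := execList O (readCode Q i j m off) s
    obtain ⟨c1, c2, c3⟩ := execList_addrCode O (d := 6) (by omega) off s2
    set s3 := execList O (addrCode 6 off) s2
    obtain ⟨d1, d2, d3⟩ := execList_addrCode O (d := 7) (by omega) (off + 1) s3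
    set s4 := execList O (addrCode 7 (off + 1)) s3
    have e2 : s2.idx 5 = s.idx 5 := h1 5 (by omega)
    have e3 : s3.idx 5 = s.idx 5 := by rw [c2 5 (by omega), e2]
    simp only [Instr.exec, State.setReg, State.next, d1, e3, d2 6 (by omega), c1, e2, d3, c3]
    refine ⟨fun r hr => ?_, fun r hr => ?_, ?_⟩
    · rw [d2 r (by omega), c2 r (by omega), h1 r hr]
    · rw [Function.update_of_ne (by omega), h2 r hr]
    · rw [Function.update_self, h4]
      rfl

end RExp

/-! ## Assignments and jumps -/

/-- Code for `I[v] := a`. -/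
def assignIdx (v : ℕ) (a : IExp) : List Instr := a.code 6 ++ [.idxConst v 0, .idxOp .add v v 6]

/-- Code for `R[a] := x`. -/
def assignReg (a : IExp) (x : RExp) : List Instr :=
  x.code 0 ++ (a.code 6 ++ (addrCode 7 0 ++ [.realCopy 6 7]))

/-- Code that jumps to line `l` if `a ≤ b`. -/
def jumpLe (a b : IExp) (l : ℕ) : List Instr := (a.code 6 ++ b.code 7) ++ [.idxJumpLe 6 7 l]

/-- Code that jumps to line `l` if `x ≤ y`. -/
def jumpRealLe (x y : RExp) (l : ℕ) : List Instr :=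
  (x.code 0 ++ (y.code 1 ++ (addrCode 6 0 ++ addrCode 7 1))) ++ [.realJumpLe 6 7 l]

theorem leads_assignIdx {P : Program} (O : Oracle) {v : ℕ} (hv : v < 6) {a : IExp} {s : State}
    (h : CodeAt P s.pc (assignIdx v a)) :
    Leads P O s (s.pc + (assignIdx v a).length) fun s' =>
      (∀ r < 6, s'.idx r = Function.update s.idx v (a.eval s.idx) r) ∧ s'.reg = s.reg := by
  obtain ⟨h1, h2⟩ := h.reach O (by
    simp only [assignIdx, List.forall_mem_append, List.forall_mem_cons]
    exact ⟨a.straight_code _, fun _ _ => rfl, fun _ _ => rfl, by simp⟩)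
  refine ⟨_, h1, h2, ?_⟩
  rw [assignIdx, execList_append, execList_cons, execList_cons, execList_nil]
  obtain ⟨a1, a2, a3⟩ := a.execList_code O (d := 6) (by omega) s
  set s1 := execList O (a.code 6) s
  simp only [Instr.exec, State.setIdx, State.next, Function.update_self, IdxOp.eval, zero_add,
    Function.update_of_ne (show (6 : ℕ) ≠ v by omega), a1, Function.update_idem]
  refine ⟨fun r hr => ?_, a3⟩
  by_cases hrv : r = v
  · rw [hrv, Function.update_self, Function.update_self]
  · rw [Function.update_of_ne hrv, Function.update_of_ne hrv, a2 r hr]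

/-- Nothing is claimed from the pointer on, where the registers are scratch space. -/
theorem leads_assignReg {P : Program} (O : Oracle) {a : IExp} {x : RExp} {s : State}
    (h : CodeAt P s.pc (assignReg a x)) (hs : 4 ≤ s.idx 5) :
    Leads P O s (s.pc + (assignReg a x).length) fun s' => (∀ r < 6, s'.idx r = s.idx r) ∧
      ∀ r < s.idx 5, s'.reg r = Function.update s.reg (a.eval s.idx) (x.eval O s) r := by
  obtain ⟨h1, h2⟩ := h.reach O (by
    simp only [assignReg, List.forall_mem_append, List.forall_mem_cons]
    exact ⟨x.straight_code _, a.straight_code _, straight_addrCode _ _, fun _ _ => rfl, by simp⟩)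
  refine ⟨_, h1, h2, ?_⟩
  rw [assignReg, execList_append, execList_append, execList_append, execList_cons, execList_nil]
  obtain ⟨x1, x2, x3⟩ := x.execList_code O 0 s hs
  set s1 := execList O (x.code 0) s
  obtain ⟨a1, a2, a3⟩ := a.execList_code O (d := 6) (by omega) s1
  set s2 := execList O (a.code 6) s1
  obtain ⟨c1, c2, c3⟩ := execList_addrCode O (d := 7) (by omega) 0 s2
  set s3 := execList O (addrCode 7 0) s2
  simp only [Instr.exec, State.setReg, State.next, c1, c2 6 (by omega), a1, c3, a3,
    a2 5 (by omega), x1 5 (by omega), x3, IExp.eval_congr x1 a]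
  refine ⟨fun r hr => ?_, fun r hr => ?_⟩
  · rw [c2 r (by omega), a2 r hr, x1 r hr]
  · by_cases hra : r = a.eval s.idx
    · rw [hra, Function.update_self, Function.update_self]
    · rw [Function.update_of_ne hra, Function.update_of_ne hra, x2 r (by omega)]

theorem leads_jumpLe {P : Program} (O : Oracle) {a b : IExp} {l : ℕ} {s : State}
    (h : CodeAt P s.pc (jumpLe a b l)) :
    Leads P O s (if a.eval s.idx ≤ b.eval s.idx then l else s.pc + (jumpLe a b l).length)
      fun s' => (∀ r < 6, s'.idx r = s.idx r) ∧ s'.reg = s.reg := by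
  obtain ⟨h1, h2⟩ := h.left.reach O (by
    simp only [List.forall_mem_append]
    exact ⟨a.straight_code _, b.straight_code _⟩)
  have h3 := h.right
  rw [← h2] at h3
  refine ⟨_, h1.trans ⟨1, h3.step O⟩, ?_⟩
  have hl : (jumpLe a b l).length = (a.code 6 ++ b.code 7).length + 1 := List.length_append
  rw [hl, ← add_assoc, ← h2, execList_append]
  obtain ⟨a1, a2, a3⟩ := a.execList_code O (d := 6) (by omega) s
  set s1 := execList O (a.code 6) s
  obtain ⟨b1, b2, b3⟩ := b.execList_code O (d := 7) (by omega) s1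
  set s2 := execList O (b.code 7) s1
  simp only [Instr.exec, State.jumpIf, b1, b2 6 (by omega), a1, IExp.eval_congr a2 b, b3, a3]
  refine ⟨trivial, fun r hr => ?_, trivial⟩
  rw [b2 r (by omega), a2 r hr]

open Classical in
theorem leads_jumpRealLe {P : Program} (O : Oracle) {x y : RExp} {l : ℕ} {s : State}
    (h : CodeAt P s.pc (jumpRealLe x y l)) (hs : 4 ≤ s.idx 5) :
    Leads P O s (if x.eval O s ≤ y.eval O s then l else s.pc + (jumpRealLe x y l).length)
      fun s' => (∀ r < 6, s'.idx r = s.idx r) ∧ ∀ r < s.idx 5, s'.reg r = s.reg r := by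
  obtain ⟨h1, h2⟩ := h.left.reach O (by
    simp only [List.forall_mem_append]
    exact ⟨x.straight_code _, y.straight_code _, straight_addrCode _ _, straight_addrCode _ _⟩)
  have h3 := h.right
  rw [← h2] at h3
  refine ⟨_, h1.trans ⟨1, h3.step O⟩, ?_⟩
  have hl : (jumpRealLe x y l).length =
    (x.code 0 ++ (y.code 1 ++ (addrCode 6 0 ++ addrCode 7 1))).length + 1 := List.length_append
  rw [hl, ← add_assoc, ← h2, execList_append, execList_append, execList_append]
  obtain ⟨x1, x2, x3⟩ := x.execList_code O 0 s hs
  set s1 := execList O (x.code 0) s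
  obtain ⟨y1, y2, y3⟩ := y.execList_code O 1 s1 (by rw [x1 5 (by omega)]; exact hs)
  set s2 := execList O (y.code 1) s1
  obtain ⟨c1, c2, c3⟩ := execList_addrCode O (d := 6) (by omega) 0 s2
  set s3 := execList O (addrCode 6 0) s2
  obtain ⟨d1, d2, d3⟩ := execList_addrCode O (d := 7) (by omega) 1 s3
  set s4 := execList O (addrCode 7 1) s3
  have e2 : s2.idx 5 = s.idx 5 := by rw [y1 5 (by omega), x1 5 (by omega)]
  rw [x1 5 (by omega)] at y2 y3
  have ey : y.eval O s1 = y.eval O s := RExp.eval_congr x1 (fun r hr => x2 r (by omega)) O y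
  have ex : s2.reg (0 + s.idx 5) = x.eval O s := by rw [y2 _ (by omega), x3]
  simp only [Instr.exec, State.jumpIf, d1, d2 6 (by omega), c1, c2 5 (by omega), e2, d3, c3, y3,
    ey, ex]
  refine ⟨trivial, fun r hr => ?_, fun r hr => ?_⟩
  · rw [d2 r (by omega), c2 r (by omega), y1 r hr, x1 r hr]
  · rw [y2 r (by omega), x2 r (by omega)]

end ResolventSCI

namespace ResolventSCI

/-! ## Composition of blocks -/

/-- Hoare's composition rule, which also passes on the position of the second block. -/
theorem Leads.seq {P : Program} {O : Oracle} {s : State} {c c' : List Instr} {Q Q' : State → Prop}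
    (h : CodeAt P s.pc (c ++ c')) (h₁ : Leads P O s (s.pc + c.length) Q)
    (h₂ : ∀ s', s'.pc = s.pc + c.length → CodeAt P s'.pc c' → Q s' → Leads P O s' (s'.pc + c'.length) Q') :
    Leads P O s (s.pc + (c ++ c').length) Q' := by
  refine h₁.bind fun s' hs' hQ => ?_
  have h3 := h.right
  rw [← hs'] at h3
  rw [List.length_append, ← add_assoc, ← hs']
  exact h₂ s' hs' h3 hQ

/-- Code for a sequence of assignments to index registers. -/
def assignIdxs (l : List (Fin 6 × IExp)) : List Instr := l.flatMap fun a => assignIdx a.1 a.2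

/-- The effect of a sequence of assignments to index registers. -/
def updateIdxs (I : ℕ → ℕ) (l : List (Fin 6 × IExp)) : ℕ → ℕ :=
  l.foldl (fun I a => Function.update I a.1 (a.2.eval I)) I

theorem updateIdxs_congr {I J : ℕ → ℕ} (h : ∀ r < 6, I r = J r) (l : List (Fin 6 × IExp)) :
    ∀ r < 6, updateIdxs I l r = updateIdxs J l r := by
  induction l generalizing I J with
  | nil => exact h
  | cons a l ih =>
    refine ih fun r hr => ?_
    simp only [Function.update_apply, h r hr, IExp.eval_congr h]

theorem leads_assignIdxs {P : Program} (O : Oracle) {l : List (Fin 6 × IExp)} {s : State}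
    (h : CodeAt P s.pc (assignIdxs l)) :
    Leads P O s (s.pc + (assignIdxs l).length) fun s' =>
      (∀ r < 6, s'.idx r = updateIdxs s.idx l r) ∧ s'.reg = s.reg := by
  induction l generalizing s with
  | nil => exact ⟨s, Reach.refl s, rfl, fun _ _ => rfl, rfl⟩
  | cons a l ih =>
    refine Leads.seq (c := assignIdx a.1 a.2) h (leads_assignIdx O a.1.2 h.left)
      fun s' _ h' hs' => ?_
    refine (ih h').bind fun s'' hs'' hQ => ⟨s'', Reach.refl s'', hs'', fun r hr => ?_, ?_⟩
    · rw [hQ.1 r hr]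
      exact updateIdxs_congr hs'.1 l r hr
    · rw [hQ.2, hs'.2]

/-- A loop that is controlled by a comparison of indices at its end. -/
theorem leads_idxLoop {P : Program} {O : Oracle} {body : List Instr} {a b : IExp} {s : State}
    {M : ℕ} (h : CodeAt P s.pc (body ++ jumpLe a b s.pc)) (hM : 0 < M) (Q : ℕ → State → Prop)
    (hQ : ∀ i s s', (∀ r < 6, s'.idx r = s.idx r) → s'.reg = s.reg → Q i s → Q i s')
    (hbody : ∀ i < M, ∀ s, CodeAt P s.pc body → Q i s → Leads P O s (s.pc + body.length) fun s' =>
      Q (i + 1) s' ∧ (a.eval s'.idx ≤ b.eval s'.idx ↔ i + 1 < M)) (h0 : Q 0 s) :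
    Leads P O s (s.pc + (body ++ jumpLe a b s.pc).length) (Q M) := by
  refine leads_loop (l := s.pc) hM Q (fun i hi s' hs' hQi => ?_) rfl h0
  refine (hbody i hi s' (by rw [hs']; exact h.left) hQi).bind fun s₁ hs₁ hQ₁ => ?_
  have h1 := h.right
  rw [← hs', ← hs₁, hs'] at h1
  refine Leads.bind (Q := Q (i + 1)) ?_ fun s₂ hs₂ hQ₂ => ⟨s₂, Reach.refl s₂, hs₂, hQ₂⟩
  obtain ⟨s₂, h2, h3, h4, h5⟩ := leads_jumpLe O h1
  refine ⟨s₂, h2, ?_, hQ _ _ _ h4 h5 hQ₁.1⟩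
  rw [h3, hs₁, hs', List.length_append, ← add_assoc]
  simp only [hQ₁.2]

/-! ## Complex expressions -/

/-- A complex expression, given by real and imaginary part. -/
structure CExp where
  re : RExp
  im : RExp

namespace CExp

instance : Sub CExp := ⟨fun a b => ⟨a.re - b.re, a.im - b.im⟩⟩
instance : Mul CExp := ⟨fun a b => ⟨a.re * b.re - a.im * b.im, a.re * b.im + a.im * b.re⟩⟩

protected def conj (a : CExp) : CExp := ⟨a.re, .ofIdx (.const 0) - a.im⟩

def normSq (a : CExp) : RExp := a.re * a.re + a.im * a.im

def read (Q : Query) (i j m : IExp) : CExp := ⟨.readRe Q i j m, .readIm Q i j m⟩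

def eval (O : Oracle) (s : State) (a : CExp) : ℂ := ⟨a.re.eval O s, a.im.eval O s⟩

variable (O : Oracle) (s : State) (a b : CExp)

theorem eval_re : a.re.eval O s = (a.eval O s).re := rfl

theorem eval_sub : (a - b).eval O s = a.eval O s - b.eval O s := rfl

theorem eval_mul : (a * b).eval O s = a.eval O s * b.eval O s := rfl

theorem eval_conj : a.conj.eval O s = starRingEnd ℂ (a.eval O s) := by
  apply Complex.ext
  · rfl
  · simp [CExp.conj, eval]

theorem eval_normSq : a.normSq.eval O s = Complex.normSq (a.eval O s) := rfl

theorem eval_read (Q : Query) (i j m : IExp) :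
    (read Q i j m).eval O s = Q.value O (i.eval s.idx) (j.eval s.idx) (m.eval s.idx) := rfl

end CExp

/-! ## The program -/

namespace Machine

/-- The accuracy parameter `N`. -/
def accE : IExp := .var 0
/-- The first component of the candidate. -/
def fstE : IExp := .var 1
/-- The second component of the candidate. -/
def sndE : IExp := .var 2
/-- The length of the candidate. -/
def lenE : IExp := .var 3
/-- The loop counter. -/
def cntE : IExp := .var 4
/-- The spectral parameter. -/
def zE : CExp := ⟨.var 0, .var 1⟩

def digitE (i : IExp) : IExp :=
  fstE - fstE / ((i + .const 1) * sndE + .const 1) * ((i + .const 1) * sndE + .const 1)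

def coordE (a : IExp) : CExp :=
  ⟨(.ofIdx (digitE a) - .ofIdx (digitE (a + .const 1))) / .ofIdx (digitE (.const 2)),
    (.ofIdx (digitE (a + .const 2)) - .ofIdx (digitE (a + .const 3))) /
      .ofIdx (digitE (.const 2))⟩

def yE (k : IExp) : CExp := coordE (.const 3 + .const 8 * k)

def vE (k : IExp) : CExp := coordE (.const 7 + .const 8 * k)

def uE (k : IExp) : CExp := vE k - zE * yE k

/-- The level at which the oracle is read. -/
def levelE : IExp := digitE (.const 1)

def rowE : IExp := cntE / lenE

def colE : IExp := cntE - cntE / lenE * lenE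

def natE (c : ℕ) : RExp := .ofIdx (.const c)

def objTermE (i j : IExp) : RExp :=
  ((yE i).conj * yE j * CExp.read .gram i j levelE).re -
    natE 2 * ((vE i).conj * yE j * CExp.read .entry i j levelE).re +
    .ofIdx (.const 1 - (i - j) - (j - i)) * ((vE i).normSq + (uE i).normSq -
      natE 2 * ((uE i).conj * CExp.read .coeff i i levelE).re)

def errTermE (i j : IExp) : RExp :=
  (yE i).normSq + natE 2 * (yE j).normSq + (vE i).normSq + (uE i).normSq + natE 1

/-- Real registers 2 and 3 hold the accumulated functional and its sensitivity. -/
def stopE : RExp :=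
  .ofIdx (accE * accE * accE * accE) *
    (.var 2 * .var 2 + .var 3 / .ofIdx (levelE + .const 1) * (.var 3 / .ofIdx (levelE + .const 1)))

/-- Passing to the next candidate. -/
def advance : List Instr := assignIdxs
  [(4, .const 1 - fstE), (1, fstE - .const 1 + cntE * (sndE + .const 1)),
    (2, (.const 1 - cntE) * (sndE + .const 1)), (3, digitE (.const 0) + .const 1), (4, .const 0),
    (5, .const 2 * lenE + .const 4)]

def clear : List Instr := assignReg (.const 2) (natE 1) ++ assignReg (.const 3) (natE 0)

/-- Adding one summand of the functional and of its error bound. -/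
def summand : List Instr :=
  assignReg (.const 2) (.var 2 + objTermE rowE colE) ++
    (assignReg (.const 3) (.var 3 + errTermE rowE colE) ++ assignIdxs [(4, cntE + .const 1)])

def sumLoop (l : ℕ) : List Instr := summand ++ jumpLe (cntE + .const 1) (lenE * lenE) l

def test : List Instr := jumpRealLe (natE 1) stopE 0

def reset : List Instr := assignIdxs [(4, .const 0)]

/-- Writing one coordinate of the output. -/
def write : List Instr :=
  assignReg (.const 2 * cntE) (yE cntE).re ++
    (assignReg (.const 2 * cntE + .const 1) (yE cntE).im ++ assignIdxs [(4, cntE + .const 1)])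

def writeLoop (l : ℕ) : List Instr := write ++ jumpLe (cntE + .const 1) lenE l

/-- Index register 0, which held N, must hold the length of the output at the end. -/
def finish : List Instr := assignIdxs [(0, lenE)]

/-- Jump targets are absolute, so the summation loop receives the line on which it begins. -/
def search : List Instr :=
  (advance ++ (clear ++ sumLoop (advance.length + clear.length))) ++ test

def program : Program :=
  search ++ (reset ++ (writeLoop (search.length + reset.length) ++ finish))

variable (O : Oracle) (s : State)

theorem eval_yE (k : IExp) :
    (yE k).eval O s = coordOf (digit (s.idx 1) (s.idx 2)) (3 + 8 * k.eval s.idx) := rfl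

theorem eval_vE (k : IExp) :
    (vE k).eval O s = coordOf (digit (s.idx 1) (s.idx 2)) (7 + 8 * k.eval s.idx) := rfl

theorem eval_zE : zE.eval O s = ⟨s.reg 0, s.reg 1⟩ := rfl

theorem eval_natE (c : ℕ) : (natE c).eval O s = c := rfl

theorem eval_objTermE (i j : IExp) :
    (objTermE i j).eval O s = objTerm O ⟨s.reg 0, s.reg 1⟩ (digit (s.idx 1) (s.idx 2) 1)
      (fun k => coordOf (digit (s.idx 1) (s.idx 2)) (3 + 8 * k))
      (fun k => coordOf (digit (s.idx 1) (s.idx 2)) (7 + 8 * k)) (i.eval s.idx)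
      (j.eval s.idx) := by
  simp only [objTermE, uE, RExp.eval_add, RExp.eval_sub, RExp.eval_mul, RExp.eval_ofIdx,
    CExp.eval_re, CExp.eval_mul, CExp.eval_sub, CExp.eval_conj, CExp.eval_normSq, CExp.eval_read,
    eval_yE, eval_vE, eval_zE, eval_natE, Nat.cast_ofNat]
  rfl

theorem eval_errTermE (i j : IExp) :
    (errTermE i j).eval O s = errTerm ⟨s.reg 0, s.reg 1⟩
      (fun k => coordOf (digit (s.idx 1) (s.idx 2)) (3 + 8 * k))
      (fun k => coordOf (digit (s.idx 1) (s.idx 2)) (7 + 8 * k)) (i.eval s.idx)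
      (j.eval s.idx) := by
  simp only [errTermE, uE, RExp.eval_add, RExp.eval_mul, CExp.eval_mul, CExp.eval_sub,
    CExp.eval_normSq, eval_yE, eval_vE, eval_zE, eval_natE, Nat.cast_ofNat, Nat.cast_one]
  rfl

theorem eval_stopE (O : Oracle) (s : State) :
    stopE.eval O s = (s.idx 0 : ℝ) ^ 4 *
      (s.reg 2 ^ 2 + (s.reg 3 / ((digit (s.idx 1) (s.idx 2) 1 : ℕ) + 1)) ^ 2) := by
  have h : stopE.eval O s = ((s.idx 0 * s.idx 0 * s.idx 0 * s.idx 0 : ℕ) : ℝ) *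
    (s.reg 2 * s.reg 2 + s.reg 3 / ((digit (s.idx 1) (s.idx 2) 1 + 1 : ℕ) : ℝ) *
      (s.reg 3 / ((digit (s.idx 1) (s.idx 2) 1 + 1 : ℕ) : ℝ))) := rfl
  rw [h]
  push_cast
  ring

end Machine

/-- Writing k = in + j lets a single counter replace two nested loops. -/
theorem sum_range_mul_self_div_mod (n : ℕ) (f : ℕ → ℕ → ℝ) :
    ∑ k ∈ Finset.range (n * n), f (k / n) (k - k / n * n) =
      ∑ i ∈ Finset.range n, ∑ j ∈ Finset.range n, f i j := by
  rcases Nat.eq_zero_or_pos n with rfl | hn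
  · simp
  have h : ∀ a, ∑ k ∈ Finset.range (a * n), f (k / n) (k - k / n * n) =
      ∑ i ∈ Finset.range a, ∑ j ∈ Finset.range n, f i j := by
    intro a
    induction a with
    | zero => simp
    | succ a ih =>
      rw [Nat.succ_mul, Finset.sum_range_add, ih, Finset.sum_range_succ]
      congr 1
      refine Finset.sum_congr rfl fun j hj => ?_
      have h1 : (a * n + j) / n = a := by
        rw [mul_comm, Nat.mul_add_div hn, Nat.div_eq_of_lt (Finset.mem_range.mp hj), add_zero]
      rw [h1, Nat.add_sub_cancel_left]
  exact h n

end ResolventSCI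

namespace ResolventSCI

namespace Machine

/-! ## Correctness of the program -/

/-- The machine works on the candidate `(p, q)` for the input `(N, z)`. -/
structure Ready (N : ℕ) (z : ℂ) (p q : ℕ) (s : State) : Prop where
  acc : s.idx 0 = N
  fst : s.idx 1 = p
  snd : s.idx 2 = q
  len : s.idx 3 = digit p q 0 + 1
  ptr : s.idx 5 = 2 * (digit p q 0 + 1) + 4
  zre : s.reg 0 = z.re
  zim : s.reg 1 = z.im

variable {P : Program} {O : Oracle} {N : ℕ} {z : ℂ} {p q : ℕ} {s : State}

theorem Ready.of_eq (h : Ready N z p q s) {s' : State} (hi : ∀ r < 6, r ≠ 4 → s'.idx r = s.idx r)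
    (h0 : s'.reg 0 = s.reg 0) (h1 : s'.reg 1 = s.reg 1) : Ready N z p q s' := by
  constructor
  · rw [hi 0 (by omega) (by omega), h.acc]
  · rw [hi 1 (by omega) (by omega), h.fst]
  · rw [hi 2 (by omega) (by omega), h.snd]
  · rw [hi 3 (by omega) (by omega), h.len]
  · rw [hi 5 (by omega) (by omega), h.ptr]
  · rw [h0, h.zre]
  · rw [h1, h.zim]

theorem Ready.four_le (h : Ready N z p q s) : 4 ≤ s.idx 5 := by
  rw [h.ptr]
  omega

/-- Register 4 temporarily keeps 1 - p, since p is overwritten before q is updated from its old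
value. -/
theorem leads_advance (h : CodeAt P s.pc advance) (hN : s.idx 0 = N) (hre : s.reg 0 = z.re)
    (him : s.reg 1 = z.im) {a : ℕ × ℕ} (h1 : s.idx 1 = a.1) (h2 : s.idx 2 = a.2) :
    Leads P O s (s.pc + advance.length) fun s' =>
      Ready N z (nextPair a).1 (nextPair a).2 s' ∧ s'.idx 4 = 0 := by
  refine (leads_assignIdxs O h).bind fun s' hs' hQ => ⟨s', Reach.refl s', hs', ?_⟩
  obtain ⟨hidx, hreg⟩ := hQ
  simp only [updateIdxs, List.foldl, IExp.eval_add, IExp.eval_sub, IExp.eval_mul, IExp.eval_div,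
    IExp.eval_const, IExp.eval_var, digitE, fstE, sndE, cntE, lenE] at hidx
  have e0 := hidx 0 (by omega)
  have e1 := hidx 1 (by omega)
  have e2 := hidx 2 (by omega)
  have e3 := hidx 3 (by omega)
  have e4 := hidx 4 (by omega)
  have e5 := hidx 5 (by omega)
  simp [h1, h2] at e0 e1 e2 e3 e4 e5
  refine ⟨⟨?_, ?_, ?_, ?_, ?_, ?_, ?_⟩, e4⟩
  · rw [e0, hN]
  · rw [e1, nextPair]
  · rw [e2, nextPair]
  · rw [e3]
    simp [digit, nextPair]
  · rw [e5]
    simp [digit, nextPair]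
  · rw [hreg, hre]
  · rw [hreg, him]

/-- The machine has added `i` summands of the functional and of its error bound. -/
structure Summed (O : Oracle) (N : ℕ) (z : ℂ) (p q : ℕ) (i : ℕ) (s : State) : Prop where
  ready : Ready N z p q s
  cnt : s.idx 4 = i
  obj : s.reg 2 = 1 + ∑ k ∈ Finset.range i, objTerm O z (digit p q 1)
    (fun k => coordOf (digit p q) (3 + 8 * k)) (fun k => coordOf (digit p q) (7 + 8 * k))
    (k / (digit p q 0 + 1)) (k - k / (digit p q 0 + 1) * (digit p q 0 + 1))
  err : s.reg 3 = ∑ k ∈ Finset.range i, errTerm z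
    (fun k => coordOf (digit p q) (3 + 8 * k)) (fun k => coordOf (digit p q) (7 + 8 * k))
    (k / (digit p q 0 + 1)) (k - k / (digit p q 0 + 1) * (digit p q 0 + 1))

theorem leads_clear (h : CodeAt P s.pc clear) (hs : Ready N z p q s) (h4 : s.idx 4 = 0) :
    Leads P O s (s.pc + clear.length) (Summed O N z p q 0) := by
  refine Leads.seq h (leads_assignReg O h.left hs.four_le) fun s₁ _ h₁ hs₁ => ?_
  have h5 : s₁.idx 5 = s.idx 5 := hs₁.1 5 (by omega)
  refine (leads_assignReg O h₁ (by rw [h5]; exact hs.four_le)).bind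
    fun s₂ hpc hs₂ => ⟨s₂, Reach.refl s₂, hpc, ?_⟩
  have hle := hs.four_le
  have r : ∀ r < 4, s₂.reg r =
      Function.update (Function.update s.reg 2 1) 3 0 r := by
    intro r hr
    rw [hs₂.2 r (by omega), Function.update_apply, Function.update_apply, hs₁.2 r (by omega)]
    simp [eval_natE]
  have hi : ∀ r < 6, s₂.idx r = s.idx r := fun r hr => by rw [hs₂.1 r hr, hs₁.1 r hr]
  refine ⟨hs.of_eq (fun r hr _ => hi r hr) ?_ ?_, by rw [hi 4 (by omega), h4], ?_, ?_⟩
  · simpa using r 0 (by omega)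
  · simpa using r 1 (by omega)
  · simpa using r 2 (by omega)
  · simpa using r 3 (by omega)

theorem leads_summand {i : ℕ} (h : CodeAt P s.pc summand) (hs : Summed O N z p q i s) :
    Leads P O s (s.pc + summand.length) (Summed O N z p q (i + 1)) := by
  have hle := hs.ready.four_le
  refine Leads.seq h (leads_assignReg O h.left hle) fun s₁ _ h₁ hs₁ => ?_
  have h5 : s₁.idx 5 = s.idx 5 := hs₁.1 5 (by omega)
  refine Leads.seq h₁ (leads_assignReg O h₁.left (by rw [h5]; exact hle)) fun s₂ _ h₂ hs₂ => ?_
  refine (leads_assignIdxs O h₂).bind fun s₃ hpc hs₃ => ⟨s₃, Reach.refl s₃, hpc, ?_⟩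
  have hi₁ := hs₁.1
  have hi₂ : ∀ r < 6, s₂.idx r = s.idx r := fun r hr => by rw [hs₂.1 r hr, hs₁.1 r hr]
  have hi₃ : ∀ r < 6, s₃.idx r = Function.update s.idx 4 (i + 1) r := by
    intro r hr
    rw [hs₃.1 r hr, updateIdxs_congr hi₂ _ r hr, ← hs.cnt]
    rfl
  have hr₁ : ∀ r < 4, r ≠ 2 → s₁.reg r = s.reg r := fun r hr hr2 => by
    rw [hs₁.2 r (by omega), Function.update_of_ne (by simpa using hr2)]
  have hr₃ : ∀ r < 4, r ≠ 3 → s₃.reg r = s₁.reg r := fun r hr hr3 => by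
    rw [hs₃.2, hs₂.2 r (by omega), Function.update_of_ne (by simpa using hr3)]
  have hready : Ready N z p q s₁ := hs.ready.of_eq (fun r hr _ => hi₁ r hr)
    (hr₁ 0 (by omega) (by omega)) (hr₁ 1 (by omega) (by omega))
  refine ⟨hready.of_eq (fun r hr hr4 => ?_) (hr₃ 0 (by omega) (by omega))
    (hr₃ 1 (by omega) (by omega)), ?_, ?_, ?_⟩
  · rw [hi₃ r hr, Function.update_of_ne hr4, hi₁ r hr]
  · rw [hi₃ 4 (by omega), Function.update_self]
  · rw [hr₃ 2 (by omega) (by omega), hs₁.2 2 (by omega), IExp.eval_const, Function.update_self,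
      RExp.eval_add, eval_objTermE, Finset.sum_range_succ, ← add_assoc, ← hs.obj,
      hs.ready.zre, hs.ready.zim, hs.ready.fst, hs.ready.snd]
    simp only [rowE, colE, cntE, lenE, IExp.eval_sub, IExp.eval_mul, IExp.eval_div, IExp.eval_var]
    change s.reg 2 + objTerm _ _ _ _ _ (s.idx 4 / s.idx 3)
      (s.idx 4 - s.idx 4 / s.idx 3 * s.idx 3) = _
    rw [hs.cnt, hs.ready.len]
  -- This summand is evaluated after register 2 has changed, but it reads only registers 0, 1 and 3.
  · rw [hs₃.2, hs₂.2 3 (by omega), IExp.eval_const, Function.update_self,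
      RExp.eval_add, eval_errTermE, Finset.sum_range_succ, ← hs.err,
      hready.zre, hready.zim, hready.fst, hready.snd]
    simp only [rowE, colE, cntE, lenE, IExp.eval_sub, IExp.eval_mul, IExp.eval_div, IExp.eval_var]
    change s₁.reg 3 + errTerm _ _ _ (s₁.idx 4 / s₁.idx 3)
      (s₁.idx 4 - s₁.idx 4 / s₁.idx 3 * s₁.idx 3) = _
    rw [hi₁ 4 (by omega), hs.cnt, hready.len, hr₁ 3 (by omega) (by omega)]

theorem leads_sumLoop (h : CodeAt P s.pc (sumLoop s.pc)) (hs : Summed O N z p q 0 s) :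
    Leads P O s (s.pc + (sumLoop s.pc).length)
      (Summed O N z p q ((digit p q 0 + 1) * (digit p q 0 + 1))) := by
  refine leads_idxLoop h (Nat.mul_pos (Nat.succ_pos _) (Nat.succ_pos _)) _ ?_ ?_ hs
  · intro i s s' hi hr hs
    refine ⟨hs.ready.of_eq (fun r hr _ => hi r hr) (by rw [hr]) (by rw [hr]), ?_, ?_, ?_⟩
    · rw [hi 4 (by omega), hs.cnt]
    · rw [hr, hs.obj]
    · rw [hr, hs.err]
  · intro i _ s hc hs
    refine (leads_summand hc hs).bind fun s' hpc hs' => ⟨s', Reach.refl s', hpc, hs', ?_⟩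
    change s'.idx 4 + 1 ≤ s'.idx 3 * s'.idx 3 ↔ _
    rw [hs'.cnt, hs'.ready.len, Nat.succ_le_iff]

theorem Summed.eval_stopE
    (h : Summed O N z p q ((digit p q 0 + 1) * (digit p q 0 + 1)) s) :
    stopE.eval O s = stopAt O N z p q := by
  rw [Machine.eval_stopE, h.obj, h.err, h.ready.acc, h.ready.fst, h.ready.snd,
    sum_range_mul_self_div_mod (digit p q 0 + 1) (objTerm O z (digit p q 1)
      (fun k => coordOf (digit p q) (3 + 8 * k)) (fun k => coordOf (digit p q) (7 + 8 * k))),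
    sum_range_mul_self_div_mod (digit p q 0 + 1) (errTerm z
      (fun k => coordOf (digit p q) (3 + 8 * k)) (fun k => coordOf (digit p q) (7 + 8 * k)))]
  rfl

open Classical in
/-- One round of the search. -/
theorem leads_search (h : CodeAt P 0 search) (hpc : s.pc = 0) (hN : s.idx 0 = N)
    (hre : s.reg 0 = z.re) (him : s.reg 1 = z.im) {a : ℕ × ℕ} (h1 : s.idx 1 = a.1)
    (h2 : s.idx 2 = a.2) :
    Leads P O s
      (if 1 ≤ stopAt O N z (nextPair a).1 (nextPair a).2 then 0 else search.length)
      (Ready N z (nextPair a).1 (nextPair a).2) := by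
  rw [← hpc] at h
  have hpre := h.left
  have hsum : Leads P O s
      (s.pc + (advance ++ (clear ++ sumLoop (advance.length + clear.length))).length)
      (Summed O N z (nextPair a).1 (nextPair a).2
        ((digit (nextPair a).1 (nextPair a).2 0 + 1) *
          (digit (nextPair a).1 (nextPair a).2 0 + 1))) := by
    refine Leads.seq hpre (leads_advance hpre.left hN hre him h1 h2) fun s₁ hpc₁ hc₁ hs₁ => ?_
    refine Leads.seq hc₁ (leads_clear hc₁.left hs₁.1 hs₁.2) fun s₂ hpc₂ hc₂ hs₂ => ?_
    have hl : advance.length + clear.length = s₂.pc := by rw [hpc₂, hpc₁, hpc, zero_add]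
    rw [hl] at hc₂ ⊢
    exact leads_sumLoop hc₂ hs₂
  refine hsum.bind fun s₁ hpc₁ hs₁ => ?_
  have hc := h.right
  rw [← hpc₁] at hc
  obtain ⟨s₂, hr, hl, hi, hg⟩ := leads_jumpRealLe O hc hs₁.ready.four_le
  have hle := hs₁.ready.four_le
  refine ⟨s₂, hr, ?_, hs₁.ready.of_eq (fun r hr _ => hi r hr) (hg 0 (by omega)) (hg 1 (by omega))⟩
  rw [hl, hs₁.eval_stopE, eval_natE, Nat.cast_one, hpc₁, hpc, zero_add]
  split_ifs
  · rfl
  · exact List.length_append.symm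

/-- The machine has written the first `i` coordinates of the output. -/
structure Written (p q i : ℕ) (s : State) : Prop where
  fst : s.idx 1 = p
  snd : s.idx 2 = q
  len : s.idx 3 = digit p q 0 + 1
  cnt : s.idx 4 = i
  ptr : s.idx 5 = 2 * (digit p q 0 + 1) + 4
  out : ∀ k < i, (⟨s.reg (2 * k), s.reg (2 * k + 1)⟩ : ℂ) = coordOf (digit p q) (3 + 8 * k)

theorem leads_reset (h : CodeAt P s.pc reset) (hs : Ready N z p q s) :
    Leads P O s (s.pc + reset.length) (Written p q 0) := by
  refine (leads_assignIdxs O h).bind fun s' hpc hs' => ⟨s', Reach.refl s', hpc, ?_⟩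
  have hi : ∀ r < 6, s'.idx r = Function.update s.idx 4 0 r := hs'.1
  constructor
  · simpa [hs.fst] using hi 1 (by omega)
  · simpa [hs.snd] using hi 2 (by omega)
  · simpa [hs.len] using hi 3 (by omega)
  · simpa using hi 4 (by omega)
  · simpa [hs.ptr] using hi 5 (by omega)
  · intro k hk
    omega

/-- The output overwrites z and the accumulators, which is safe because coordinates are computed
from index registers alone. The pointer keeps scratch values above the output. -/
theorem leads_write {i : ℕ} (hi : i < digit p q 0 + 1) (h : CodeAt P s.pc write)
    (hs : Written p q i s) : Leads P O s (s.pc + write.length) (Written p q (i + 1)) := by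
  have hptr := hs.ptr
  have hle : 4 ≤ s.idx 5 := by omega
  refine Leads.seq h (leads_assignReg O h.left hle) fun s₁ _ h₁ hs₁ => ?_
  have h5 : s₁.idx 5 = s.idx 5 := hs₁.1 5 (by omega)
  refine Leads.seq h₁ (leads_assignReg O h₁.left (by rw [h5]; exact hle)) fun s₂ _ h₂ hs₂ => ?_
  refine (leads_assignIdxs O h₂).bind fun s₃ hpc hs₃ => ⟨s₃, Reach.refl s₃, hpc, ?_⟩
  have hi₁ := hs₁.1
  have hi₂ : ∀ r < 6, s₂.idx r = s.idx r := fun r hr => by rw [hs₂.1 r hr, hs₁.1 r hr]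
  have hi₃ : ∀ r < 6, s₃.idx r = Function.update s.idx 4 (i + 1) r := by
    intro r hr
    rw [hs₃.1 r hr, updateIdxs_congr hi₂ _ r hr, ← hs.cnt]
    rfl
  have hy : (yE cntE).eval O s = coordOf (digit p q) (3 + 8 * i) := by
    rw [eval_yE, hs.fst, hs.snd, ← hs.cnt]
    rfl
  have hy₁ : (yE cntE).eval O s₁ = coordOf (digit p q) (3 + 8 * i) := by
    rw [eval_yE, hi₁ 1 (by omega), hi₁ 2 (by omega), hs.fst, hs.snd, ← hs.cnt, ← hi₁ 4 (by omega)]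
    rfl
  have ha : (IExp.const 2 * cntE).eval s.idx = 2 * i := by
    rw [← hs.cnt]
    rfl
  have ha₁ : (IExp.const 2 * cntE + IExp.const 1).eval s₁.idx = 2 * i + 1 := by
    rw [← hs.cnt, ← hi₁ 4 (by omega)]
    rfl
  have hr : ∀ r < s.idx 5, s₃.reg r = Function.update (Function.update s.reg (2 * i)
      (coordOf (digit p q) (3 + 8 * i)).re) (2 * i + 1)
      (coordOf (digit p q) (3 + 8 * i)).im r := by
    intro r hr
    rw [hs₃.2, hs₂.2 r (by omega), Function.update_apply, hs₁.2 r hr, ha, ha₁, CExp.eval_re, hy,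
      ← hy₁, Function.update_apply _ (2 * i + 1)]
    rfl
  constructor
  · simpa [hs.fst] using hi₃ 1 (by omega)
  · simpa [hs.snd] using hi₃ 2 (by omega)
  · simpa [hs.len] using hi₃ 3 (by omega)
  · simpa using hi₃ 4 (by omega)
  · simpa [hs.ptr] using hi₃ 5 (by omega)
  · intro k hk
    rw [hr (2 * k) (by omega), hr (2 * k + 1) (by omega)]
    rcases Nat.lt_succ_iff_lt_or_eq.mp hk with hk | rfl
    · rw [Function.update_of_ne (by omega), Function.update_of_ne (by omega),
        Function.update_of_ne (by omega), Function.update_of_ne (by omega), hs.out k hk]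
    · rw [Function.update_self, Function.update_of_ne (by omega), Function.update_self]

theorem leads_writeLoop (h : CodeAt P s.pc (writeLoop s.pc)) (hs : Written p q 0 s) :
    Leads P O s (s.pc + (writeLoop s.pc).length) (Written p q (digit p q 0 + 1)) := by
  refine leads_idxLoop h (Nat.succ_pos _) _ ?_ ?_ hs
  · intro i s s' hi hr hs
    refine ⟨?_, ?_, ?_, ?_, ?_, ?_⟩
    · rw [hi 1 (by omega), hs.fst]
    · rw [hi 2 (by omega), hs.snd]
    · rw [hi 3 (by omega), hs.len]
    · rw [hi 4 (by omega), hs.cnt]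
    · rw [hi 5 (by omega), hs.ptr]
    · rw [hr]
      exact hs.out
  · intro i hi s hc hs
    refine (leads_write hi hc hs).bind fun s' hpc hs' => ⟨s', Reach.refl s', hpc, hs', ?_⟩
    change s'.idx 4 + 1 ≤ s'.idx 3 ↔ _
    rw [hs'.cnt, hs'.len, Nat.succ_le_iff]

theorem leads_finish (h : CodeAt P s.pc finish) (hs : Written p q (digit p q 0 + 1) s) :
    Leads P O s (s.pc + finish.length) fun s' =>
      s'.output = finVec (digit p q 0 + 1) fun k => coordOf (digit p q) (3 + 8 * k) := by
  refine (leads_assignIdxs O h).bind fun s' hpc hs' => ⟨s', Reach.refl s', hpc, ?_⟩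
  have h0 : s'.idx 0 = digit p q 0 + 1 := by
    rw [hs'.1 0 (by omega), ← hs.len]
    rfl
  change s'.output = _
  rw [State.output, h0, finVec, hs'.2]
  exact Finset.sum_congr rfl fun k hk => by rw [hs.out k (Finset.mem_range.mp hk)]

/-- If some candidate meets the stopping criterion, then the machine outputs one that does. -/
theorem exists_computes
    (h : ∃ i, stopAt O N z (nextPair^[i + 1] (0, 0)).1 (nextPair^[i + 1] (0, 0)).2 < 1) :
    ∃ p q, stopAt O N z p q < 1 ∧ program.Computes O N z
      (finVec (digit p q 0 + 1) fun k => coordOf (digit p q) (3 + 8 * k)) := by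
  classical
  set i := Nat.find h with hi
  set a := nextPair^[i + 1] (0, 0) with ha
  refine ⟨a.1, a.2, Nat.find_spec h, ?_⟩
  have hprog : CodeAt program 0 program := ⟨[], [], by simp, rfl⟩
  have hsearch : Leads program O (State.init N z) search.length fun s => Ready N z a.1 a.2 s := by
    refine Leads.bind (Q := fun s => (i + 1 = 0 ∨ Ready N z a.1 a.2 s) ∧ s.idx 0 = N ∧
      s.reg 0 = z.re ∧ s.reg 1 = z.im ∧ s.idx 1 = a.1 ∧ s.idx 2 = a.2) ?_ fun s hs hQ =>
        ⟨s, Reach.refl s, hs, hQ.1.resolve_left (Nat.succ_ne_zero i)⟩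
    -- Initially length and pointer are not yet set, so `Ready` is demanded only after the first
    -- round.
    refine leads_loop (l := 0) (Nat.succ_pos i) (fun j s =>
      (j = 0 ∨ Ready N z (nextPair^[j] (0, 0)).1 (nextPair^[j] (0, 0)).2 s) ∧ s.idx 0 = N ∧
      s.reg 0 = z.re ∧ s.reg 1 = z.im ∧ s.idx 1 = (nextPair^[j] (0, 0)).1 ∧
      s.idx 2 = (nextPair^[j] (0, 0)).2) ?_ rfl ?_
    · rintro j hj s hs ⟨-, hN, hre, him, h1, h2⟩
      obtain ⟨s', hr, hl, hs'⟩ := leads_search (O := O) hprog.left hs hN hre him h1 h2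
      rw [← Function.iterate_succ_apply' nextPair] at hl hs'
      refine ⟨s', hr, ?_, Or.inr hs', hs'.acc, hs'.zre, hs'.zim, hs'.fst, hs'.snd⟩
      rw [hl]
      by_cases hji : j + 1 < i + 1
      · rw [if_pos hji, if_pos (not_lt.mp (Nat.find_min h (by omega)))]
      · obtain rfl : j = i := by omega
        rw [if_neg hji, if_neg (not_le.mpr (Nat.find_spec h))]
    · refine ⟨Or.inl rfl, ?_, ?_, ?_, ?_, ?_⟩ <;> simp [State.init]
  have hall : Leads program O (State.init N z) ((State.init N z).pc + program.length) fun s' =>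
      s'.output = finVec (digit a.1 a.2 0 + 1) fun k => coordOf (digit a.1 a.2) (3 + 8 * k) := by
    refine Leads.seq (c := search) (Q := Ready N z a.1 a.2) hprog ?_ fun s₁ hpc₁ hc₁ hs₁ => ?_
    · rw [show (State.init N z).pc = 0 from rfl, zero_add]
      exact hsearch
    refine Leads.seq hc₁ (leads_reset hc₁.left hs₁) fun s₂ hpc₂ hc₂ hs₂ => ?_
    have hl : search.length + reset.length = s₂.pc := by
      rw [hpc₂, hpc₁, show (State.init N z).pc = 0 from rfl, zero_add]
    rw [hl] at hc₂ ⊢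
    exact Leads.seq hc₂ (leads_writeLoop hc₂.left hs₂) fun s₃ _ hc₃ hs₃ => leads_finish hc₃ hs₃
  obtain ⟨s', ⟨t, rfl⟩, hpc, hout⟩ := hall
  exact ⟨t, by rw [Program.Halted, hpc]; exact Nat.le_add_left _ _, hout⟩

end Machine

/-! ### Finite support and conclusion. -/

theorem finite_support_finVec (n : ℕ) (y : ℕ → ℂ) :
    (Function.support (finVec n y : ℕ → ℂ)).Finite := by
  refine (Finset.range n).finite_toSet.subset fun i hi => ?_
  by_contra h
  refine hi ?_
  rw [finVec, lp.coeFn_sum, Finset.sum_apply]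
  refine Finset.sum_eq_zero fun k hk => ?_
  have : i ≠ k := fun hik => h (hik ▸ hk)
  simp [e, lp.single_apply, this]

end ResolventSCI

open ResolventSCI in
/-- There is one oracle machine `P`, taking `N` as an input, that works for all evaluation
functions. The bound `K` on the hidden constants and the resulting constant `C` depend on the
operator and the vector only. -/
theorem theoremB2 :
    ∃ P : ResolventSCI.Program,
      ∀ K : ResolventSCI.OmegaSA → ResolventSCI.UnitSphere → ℝ,
      ∃ C : ResolventSCI.OmegaSA → ResolventSCI.UnitSphere → ℝ,
      ∀ Λ : ResolventSCI.EvaluationFunctions, Λ.AccurateWith K →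
      ∃ Γ : ℕ → ResolventSCI.OmegaSA → ResolventSCI.UnitSphere → ResolventSCI.NonReal →
          ResolventSCI.Ell2,
        (∀ N : ℕ, 1 ≤ N → ∀ (T : ResolventSCI.OmegaSA) (x : ResolventSCI.UnitSphere)
          (z : ResolventSCI.NonReal),
          ResolventSCI.Program.Computes P (Λ.oracle T x) N (z : ℂ) (Γ N T x z)) ∧
        (∀ (T : ResolventSCI.OmegaSA) (x : ResolventSCI.UnitSphere)
          (z : ResolventSCI.NonReal),
          (z : ℂ) ∈ ResolventSCI.resolventSet T.1 ∧
          (∀ N : ℕ, 1 ≤ N → (Function.support (Γ N T x z : ℕ → ℂ)).Finite) ∧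
          Filter.Tendsto (fun N => Γ N T x z) Filter.atTop
            (nhds (ResolventSCI.resolventOp (z : ℂ) T.1 (x : ResolventSCI.Ell2)))) ∧
        (∀ (T : ResolventSCI.OmegaSA) (x : ResolventSCI.UnitSphere)
          (z : ResolventSCI.NonReal) (N : ℕ), 1 ≤ N →
          ‖Γ N T x z - ResolventSCI.resolventOp (z : ℂ) T.1 (x : ResolventSCI.Ell2)‖ ≤
            C T x / (N * |(z : ℂ).im|)) := by
  refine ⟨Machine.program, fun K => ⟨fun T x => √(2 * (1 + K T x)), fun Λ hΛ => ?_⟩⟩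
  have key : ∀ (N : ℕ) (T : OmegaSA) (x : UnitSphere) (z : NonReal), ∃ v : Ell2, 1 ≤ N →
      Machine.program.Computes (Λ.oracle T x) N z v ∧ (Function.support (v : ℕ → ℂ)).Finite ∧
      ‖v - resolventOp (z : ℂ) T.1 (x : Ell2)‖ ≤ √(2 * (1 + K T x)) / (N * |(z : ℂ).im|) := by
    intro N T x z
    by_cases hN : 1 ≤ N
    · obtain ⟨p, q, hlt, hcomp⟩ :=
        Machine.exists_computes (exists_stopAt_lt (hΛ.closeTo T x) hN z.2)
      exact ⟨_, fun _ => ⟨hcomp, finite_support_finVec _ _,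
        norm_sub_resolventOp_le_of_stopValue_lt (hΛ.closeTo T x _) hN z.2 hlt⟩⟩
    -- A default value at N = 0, where nothing is claimed.
    · exact ⟨0, fun h => absurd h hN⟩
  choose Γ hΓ using key
  refine ⟨Γ, fun N hN T x z => (hΓ N T x z hN).1, fun T x z =>
    ⟨mem_resolventSet T.2.2 z.2, fun N hN => (hΓ N T x z hN).2.1, ?_⟩,
    fun T x z N hN => (hΓ N T x z hN).2.2⟩
  rw [tendsto_iff_norm_sub_tendsto_zero]
  refine squeeze_zero' (Filter.Eventually.of_forall fun _ => norm_nonneg _)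
    ((Filter.eventually_ge_atTop 1).mono fun N hN => (hΓ N T x z hN).2.2) ?_
  exact tendsto_const_nhds.div_atTop
    (tendsto_natCast_atTop_atTop.atTop_mul_const (abs_pos.mpr z.2))

end
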